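/- Let $X$ and $Y$ be locally compact Hausdorff spaces and let $A$ be a $C_0(X)$-algebra, i.e. a $C^*$-algebra with a $*$-homomorphism $\theta$ from $C_0(X)$ into the center of the multiplier algebra $M(A)$ such that $\theta(C_0(X))A=A$ (the products span a dense subspace of $A$); write $fa=\theta(f)a$. For $x\in X$ let $I_x=\{f\in C_0(X): f(x)=0\}$, let $A_x=A/(I_xA)$, where $I_xA$ is the closed linear span of the products $fa$ ($f\in I_x$, $a\in A$), and let $a_x$ be the image of $a\in A$ in $A_x$. Let $A^\sharp=\bigsqcup_{x\in X}A_x$ have the topology with base the sets $U(a,\varepsilon)=\{b_x\in A_x: x\in U,\ \|b_x-a_x\|<\varepsilon\}$ ($U\subset X$ open, $a\in A$, $\varepsilon>0$). Let $q:Y\to X$ be continuous, regard $C_0(Y)$ as a $C_0(X)$-algebra via $(fF)(y)=f(q(y))F(y)$, and let $q^*A=A\otimes_{C_0(X)}C_0(Y)$ be the maximal balanced tensor product, that is, the quotient of $A\otimes_{\max}C_0(Y)$ by the closed ideal generated by the elements $fa\otimes F-a\otimes fF$ ($f\in C_0(X)$, $a\in A$, $F\in C_0(Y)$). It is a $C_0(Y)$-algebra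 with $F'(a\otimes F)=a\otimes F'F$. Let $Y\times_qA^\sharp=\{(y,z)\in Y\times A^\sharp: z\in A_{q(y)}\}$ have the relative topology of $Y\times A^\sharp$. Then for every $y\in Y$ there is a $*$-isomorphism $\varphi_y:(q^*A)_y\to A_{q(y)}$ with $\varphi_y((a\otimes F)_y)=F(y)\,a_{q(y)}$ for all $a\in A$, $F\in C_0(Y)$, and the family $(\varphi_y)_{y\in Y}$ is uniquely determined by these equations. If $q$ is also open, then the resulting identification $$i:Y\times_qA^\sharp\to(q^*A)^\sharp,\qquad i(y,z)=\varphi_y^{-1}(z)\in(q^*A)_y,$$ is a homeomorphism. -/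

import Mathlib

open scoped TensorProduct ZeroAtInfty MultiplierAlgebra

noncomputable section

/-- A closed two-sided (self-adjoint) ideal of a C*-algebra. -/
structure ClosedIdeal (A : Type*) [NonUnitalCStarAlgebra A] extends Submodule ℂ A where
  mul_mem_left' : ∀ (a : A) {x : A}, x ∈ carrier → a * x ∈ carrier
  mul_mem_right' : ∀ (a : A) {x : A}, x ∈ carrier → x * a ∈ carrier
  star_mem' : ∀ {x : A}, x ∈ carrier → star x ∈ carrier
  isClosed' : IsClosed carrier

namespace ClosedIdeal

variable {A : Type*} [NonUnitalCStarAlgebra A]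

theorem exists_approx (I : ClosedIdeal A) {x : A} (hx : x ∈ I.toSubmodule) {ε : ℝ} (hε : 0 < ε) :
    ∃ e ∈ I.toSubmodule, ‖e‖ ≤ 1 ∧ ‖x - x * e‖ < ε ∧ ∀ y : A, ‖y - y * e‖ ≤ ‖y‖ := by
  let S : NonUnitalStarSubalgebra ℂ A :=
    { carrier := I.carrier
      add_mem' := I.add_mem'
      zero_mem' := I.zero_mem'
      smul_mem' := I.smul_mem'
      mul_mem' := fun {a b} _ hb => I.mul_mem_left' a hb
      star_mem' := I.star_mem' }
  have hS : IsClosed (S : Set A) := I.isClosed'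
  let : NonUnitalCStarAlgebra S := NonUnitalStarSubalgebra.nonUnitalCStarAlgebra S
  let := CStarAlgebra.spectralOrder S
  let := CStarAlgebra.spectralOrderedRing S
  have hu := CStarAlgebra.increasingApproximateUnit S
  have h1 := hu.tendsto_mul_left (⟨x, hx⟩ : S)
  have h2 := (Metric.tendsto_nhds.1 h1 ε hε)
  obtain ⟨e, he1, he2, he3⟩ := (h2.and (hu.eventually_nonneg.and hu.eventually_norm)).exists
  have he3' : ‖(e : A)‖ ≤ 1 := he3
  refine ⟨e, e.2, he3', ?_, ?_⟩
  · rw [dist_comm, dist_eq_norm] at he1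
    exact he1
  · intro y
    obtain ⟨d, hd⟩ : ∃ d : S, e = star d * d := by
      let := CStarAlgebra.spectralOrder S
      exact (CStarAlgebra.nonneg_iff_eq_star_mul_self).1 he2
    let := CStarAlgebra.spectralOrder A
    let := CStarAlgebra.spectralOrderedRing A
    let := CStarAlgebra.spectralOrder (Unitization ℂ A)
    let := CStarAlgebra.spectralOrderedRing (Unitization ℂ A)
    have hnn : (0 : A) ≤ (e : A) := by
      have : (e : A) = star (d : A) * d := congrArg Subtype.val hd
      rw [this]; exact star_mul_self_nonneg _
    have hnn' : (0 : Unitization ℂ A) ≤ ((e : A) : Unitization ℂ A) := by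
      rwa [Unitization.inr_nonneg_iff]
    have hle : ((e : A) : Unitization ℂ A) ≤ 1 := by
      rw [← CStarAlgebra.norm_le_one_iff_of_nonneg _, Unitization.norm_inr]; exact he3'
    have h3 : ‖(1 : Unitization ℂ A) - ((e : A) : Unitization ℂ A)‖ ≤ 1 := by
      rw [CStarAlgebra.norm_le_one_iff_of_nonneg _ (sub_nonneg.2 hle)]
      exact sub_le_self _ hnn'
    rw [← Unitization.norm_inr (𝕜 := ℂ), ← Unitization.norm_inr (𝕜 := ℂ) y]
    have : ((y - y * (e : A) : A) : Unitization ℂ A) =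
        (y : Unitization ℂ A) * (1 - ((e : A) : Unitization ℂ A)) := by
      rw [mul_sub, mul_one, Unitization.inr_sub, Unitization.inr_mul]
    rw [this]
    exact (norm_mul_le _ _).trans (mul_le_of_le_one_right (norm_nonneg _) h3)

/-- The quotient `A / I` of a C*-algebra by a closed ideal. -/
def Quot (I : ClosedIdeal A) : Type _ := A ⧸ I.toSubmodule

variable (I : ClosedIdeal A)

instance : NormedAddCommGroup I.Quot :=
  haveI : IsClosed (I.toSubmodule : Set A) := I.isClosed'
  inferInstanceAs (NormedAddCommGroup (A ⧸ I.toSubmodule))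

instance : NormedSpace ℂ I.Quot := inferInstanceAs (NormedSpace ℂ (A ⧸ I.toSubmodule))

instance : CompleteSpace I.Quot := inferInstanceAs (CompleteSpace (A ⧸ I.toSubmodule))

/-- The quotient map `A → A / I`. -/
def proj : A →ₗ[ℂ] I.Quot := I.toSubmodule.mkQ

variable {I} in
theorem proj_surjective : Function.Surjective I.proj := Submodule.mkQ_surjective _

variable {I} in
theorem proj_eq_proj {x y : A} : I.proj x = I.proj y ↔ x - y ∈ I.toSubmodule :=
  Submodule.Quotient.eq _

theorem norm_proj_le (x : A) : ‖I.proj x‖ ≤ ‖x‖ := Submodule.Quotient.norm_mk_le _ x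

theorem continuous_proj : Continuous I.proj :=
  (I.proj.mkContinuous 1 fun x => by rw [one_mul]; exact I.norm_proj_le x).continuous

theorem exists_norm_lt (z : I.Quot) {ε : ℝ} (hε : 0 < ε) : ∃ x, I.proj x = z ∧ ‖x‖ < ‖z‖ + ε :=
  Submodule.Quotient.norm_mk_lt z hε

instance : Mul I.Quot where
  mul := Quotient.map₂ (· * ·) <| by
    intro a b hab c d hcd
    replace hab := (Submodule.quotientRel_def _).1 hab
    replace hcd := (Submodule.quotientRel_def _).1 hcd
    refine (Submodule.quotientRel_def _).2 ?_
    have : a * c - b * d = (a - b) * c + b * (c - d) := by noncomm_ring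
    rw [this]
    exact I.add_mem' (I.mul_mem_right' _ hab) (I.mul_mem_left' _ hcd)

instance : Star I.Quot where
  star := Quotient.map star <| by
    intro a b hab
    replace hab := (Submodule.quotientRel_def _).1 hab
    refine (Submodule.quotientRel_def _).2 ?_
    rw [← star_sub]
    exact I.star_mem' hab

theorem proj_mul (x y : A) : I.proj (x * y) = I.proj x * I.proj y := rfl

theorem proj_star (x : A) : I.proj (star x) = star (I.proj x) := rfl

instance : NonUnitalNormedRing I.Quot where
  __ := (inferInstance : NormedAddCommGroup I.Quot)
  mul := (· * ·)
  left_distrib a b c := by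
    obtain ⟨a, rfl⟩ := proj_surjective a
    obtain ⟨b, rfl⟩ := proj_surjective b
    obtain ⟨c, rfl⟩ := proj_surjective c
    simp only [← proj_mul, ← map_add, mul_add]
  right_distrib a b c := by
    obtain ⟨a, rfl⟩ := proj_surjective a
    obtain ⟨b, rfl⟩ := proj_surjective b
    obtain ⟨c, rfl⟩ := proj_surjective c
    simp only [← proj_mul, ← map_add, add_mul]
  zero_mul a := by
    obtain ⟨a, rfl⟩ := proj_surjective a
    rw [← map_zero I.proj, ← proj_mul, zero_mul]
  mul_zero a := by
    obtain ⟨a, rfl⟩ := proj_surjective a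
    rw [← map_zero I.proj, ← proj_mul, mul_zero]
  mul_assoc a b c := by
    obtain ⟨a, rfl⟩ := proj_surjective a
    obtain ⟨b, rfl⟩ := proj_surjective b
    obtain ⟨c, rfl⟩ := proj_surjective c
    simp only [← proj_mul, mul_assoc]
  norm_mul_le a b := by
    have key : ∀ ε > 0, ‖a * b‖ ≤ (‖a‖ + ε) * (‖b‖ + ε) := by
      intro ε hε
      obtain ⟨x, rfl, hx⟩ := I.exists_norm_lt a hε
      obtain ⟨y, rfl, hy⟩ := I.exists_norm_lt b hε
      rw [← proj_mul]
      refine (I.norm_proj_le _).trans ((norm_mul_le _ _).trans ?_)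
      gcongr
    have ht : Filter.Tendsto (fun ε : ℝ => (‖a‖ + ε) * (‖b‖ + ε)) (nhdsWithin 0 (Set.Ioi 0))
        (nhds ((‖a‖ + 0) * (‖b‖ + 0))) :=
      ((Continuous.tendsto (by fun_prop) 0)).mono_left nhdsWithin_le_nhds
    rw [add_zero, add_zero] at ht
    exact ge_of_tendsto ht (Filter.eventually_of_mem self_mem_nhdsWithin key)

instance : StarRing I.Quot where
  star_involutive a := by
    obtain ⟨a, rfl⟩ := proj_surjective a
    simp only [← proj_star, star_star]
  star_mul a b := by
    obtain ⟨a, rfl⟩ := proj_surjective a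
    obtain ⟨b, rfl⟩ := proj_surjective b
    simp only [← proj_star, ← proj_mul, star_mul]
  star_add a b := by
    obtain ⟨a, rfl⟩ := proj_surjective a
    obtain ⟨b, rfl⟩ := proj_surjective b
    simp only [← proj_star, ← map_add, star_add]

instance : CStarRing I.Quot where
  norm_mul_self_le a := by
    obtain ⟨x, rfl⟩ := proj_surjective a
    rw [← proj_star, ← proj_mul]
    refine le_of_forall_pos_lt_add fun ε hε => ?_
    obtain ⟨z, hz, hzn⟩ := I.exists_norm_lt (I.proj (star x * x)) (half_pos hε)
    have hi : star x * x - z ∈ I.toSubmodule := proj_eq_proj.1 hz.symm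
    obtain ⟨e, heI, he1, he2, he3⟩ := I.exists_approx hi (half_pos hε)
    have hx : I.proj x = I.proj (x - x * e) :=
      proj_eq_proj.2 (by simpa using I.mul_mem_left' x heI)
    have h1 : ‖I.proj x‖ ≤ ‖x - x * e‖ := by rw [hx]; exact I.norm_proj_le _
    have h2 : ‖x - x * e‖ * ‖x - x * e‖ ≤ ‖star x * x - star x * x * e‖ := by
      rw [← CStarRing.norm_star_mul_self]
      have : star (x - x * e) * (x - x * e) =
          star (star (star x * x - star x * x * e) - star (star x * x - star x * x * e) * e) := by
        simp only [star_sub, star_mul, star_star]; noncomm_ring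
      rw [this, norm_star]
      exact (he3 _).trans (norm_star _).le
    have h3 : ‖star x * x - star x * x * e‖ ≤
        ‖(star x * x - z) - (star x * x - z) * e‖ + ‖z - z * e‖ := by
      refine le_trans (le_of_eq ?_) (norm_add_le _ _)
      congr 1; noncomm_ring
    calc ‖I.proj x‖ * ‖I.proj x‖ ≤ ‖x - x * e‖ * ‖x - x * e‖ := by gcongr
      _ ≤ ‖(star x * x - z) - (star x * x - z) * e‖ + ‖z - z * e‖ := h2.trans h3
      _ ≤ ‖(star x * x - z) - (star x * x - z) * e‖ + ‖z‖ := by gcongr; exact he3 z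
      _ < ‖I.proj (star x * x)‖ + ε := by linarith

instance : NonUnitalCStarAlgebra I.Quot where
  smul_assoc c a b := by
    obtain ⟨a, rfl⟩ := proj_surjective a
    obtain ⟨b, rfl⟩ := proj_surjective b
    simp only [smul_eq_mul, ← proj_mul, ← map_smul, smul_mul_assoc]
  smul_comm c a b := by
    obtain ⟨a, rfl⟩ := proj_surjective a
    obtain ⟨b, rfl⟩ := proj_surjective b
    simp only [smul_eq_mul, ← proj_mul, ← map_smul, mul_smul_comm]
  star_smul c a := by
    obtain ⟨a, rfl⟩ := proj_surjective a
    simp only [← proj_star, ← map_smul, star_smul]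

end ClosedIdeal

/-- A C*-seminorm on a complex *-algebra. -/
structure IsCStarSeminorm {R : Type*} [NonUnitalRing R] [StarRing R] [Module ℂ R]
    (p : Seminorm ℂ R) : Prop where
  mul_le : ∀ x y, p (x * y) ≤ p x * p y
  star_mul_self : ∀ x, p (star x * x) = p x ^ 2

theorem IsCStarSeminorm.star_eq {R : Type*} [NonUnitalRing R] [StarRing R] [Module ℂ R]
    {p : Seminorm ℂ R} (hp : IsCStarSeminorm p) (x : R) : p (star x) = p x := by
  have key : ∀ y, p y ≤ p (star y) := by
    intro y
    by_contra! h
    have h1 := hp.mul_le (star y) y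
    rw [hp.star_mul_self, pow_two] at h1
    have h2 : 0 < p y := lt_of_le_of_lt (apply_nonneg p _) h
    exact absurd (le_of_mul_le_mul_right h1 h2) (not_le.2 h)
  refine le_antisymm ?_ (key x)
  simpa using key (star x)

section MaxTensor

variable (A B : Type*) [NonUnitalCStarAlgebra A] [NonUnitalCStarAlgebra B]

/-- The C*-seminorms on the algebraic tensor product `A ⊙ B`. (The inequality
`p (a ⊗ b) ≤ ‖a‖ ‖b‖` holds automatically for every C*-seminorm on `A ⊙ B`.) -/
def tensorCStarSeminorms : Set (Seminorm ℂ (A ⊗[ℂ] B)) :=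
  {p | IsCStarSeminorm p ∧ ∀ a b, p (a ⊗ₜ b) ≤ ‖a‖ * ‖b‖}

theorem zero_mem_tensorCStarSeminorms : 0 ∈ tensorCStarSeminorms A B :=
  ⟨⟨fun _ _ => by simp, fun _ => by simp⟩, fun a b => by
    simpa using mul_nonneg (norm_nonneg a) (norm_nonneg b)⟩

theorem bddAbove_tensorCStarSeminorms : BddAbove (tensorCStarSeminorms A B) := by
  rw [Seminorm.bddAbove_iff]
  have key : ∀ t : A ⊗[ℂ] B, ∃ C : ℝ, ∀ p ∈ tensorCStarSeminorms A B, p t ≤ C := by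
    intro t
    induction t with
    | zero => exact ⟨0, fun p _ => (map_zero p).le⟩
    | tmul a b => exact ⟨_, fun p hp => hp.2 a b⟩
    | add x y hx hy =>
      obtain ⟨C, hC⟩ := hx
      obtain ⟨D, hD⟩ := hy
      exact ⟨C + D, fun p hp => (map_add_le_add p x y).trans (add_le_add (hC p hp) (hD p hp))⟩
  choose C hC using key
  exact ⟨C, by rintro _ ⟨p, hp, rfl⟩ t; exact hC t p hp⟩

/-- The maximal C*-seminorm on `A ⊙ B`: the supremum of all C*-seminorms. -/
def maxSeminorm : Seminorm ℂ (A ⊗[ℂ] B) := sSup (tensorCStarSeminorms A B)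

theorem maxSeminorm_apply (t : A ⊗[ℂ] B) :
    maxSeminorm A B t = ⨆ p : tensorCStarSeminorms A B, (p : Seminorm ℂ (A ⊗[ℂ] B)) t :=
  Seminorm.sSup_apply (bddAbove_tensorCStarSeminorms A B)

variable {A B} in
theorem le_maxSeminorm {p : Seminorm ℂ (A ⊗[ℂ] B)} (hp : p ∈ tensorCStarSeminorms A B)
    (t : A ⊗[ℂ] B) : p t ≤ maxSeminorm A B t :=
  le_csSup (bddAbove_tensorCStarSeminorms A B) hp t

variable {A B} in
theorem maxSeminorm_le {t : A ⊗[ℂ] B} {C : ℝ}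
    (h : ∀ p ∈ tensorCStarSeminorms A B, p t ≤ C) : maxSeminorm A B t ≤ C := by
  have : Nonempty (tensorCStarSeminorms A B) := ⟨⟨0, zero_mem_tensorCStarSeminorms A B⟩⟩
  rw [maxSeminorm_apply]
  exact ciSup_le fun p => h p p.2

theorem maxSeminorm_isCStar : IsCStarSeminorm (maxSeminorm A B) where
  mul_le x y := maxSeminorm_le fun p hp => (hp.1.mul_le x y).trans <| by
    gcongr <;> exact le_maxSeminorm hp _
  star_mul_self x := by
    apply le_antisymm
    · refine maxSeminorm_le fun p hp => ?_
      rw [hp.1.star_mul_self]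
      gcongr
      exact le_maxSeminorm hp _
    · have h0 : 0 ≤ maxSeminorm A B (star x * x) := apply_nonneg _ _
      rw [← Real.sq_sqrt h0]
      gcongr
      refine maxSeminorm_le fun p hp => Real.le_sqrt_of_sq_le ?_
      rw [← hp.1.star_mul_self]
      exact le_maxSeminorm hp _

theorem maxSeminorm_mem : maxSeminorm A B ∈ tensorCStarSeminorms A B :=
  ⟨maxSeminorm_isCStar A B, fun a b => maxSeminorm_le fun _ hp => hp.2 a b⟩

/-- The algebraic tensor product `A ⊙ B`, equipped with the maximal C*-seminorm. -/
def PreMaxTensor : Type _ := A ⊗[ℂ] B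

namespace PreMaxTensor

instance : NonUnitalRing (PreMaxTensor A B) := inferInstanceAs (NonUnitalRing (A ⊗[ℂ] B))
instance : StarRing (PreMaxTensor A B) := inferInstanceAs (StarRing (A ⊗[ℂ] B))
instance : Module ℂ (PreMaxTensor A B) := inferInstanceAs (Module ℂ (A ⊗[ℂ] B))
instance : StarModule ℂ (PreMaxTensor A B) := inferInstanceAs (StarModule ℂ (A ⊗[ℂ] B))
instance : IsScalarTower ℂ (PreMaxTensor A B) (PreMaxTensor A B) :=
  inferInstanceAs (IsScalarTower ℂ (A ⊗[ℂ] B) (A ⊗[ℂ] B))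
instance : SMulCommClass ℂ (PreMaxTensor A B) (PreMaxTensor A B) :=
  inferInstanceAs (SMulCommClass ℂ (A ⊗[ℂ] B) (A ⊗[ℂ] B))

/-- The maximal seminorm, on the type synonym. -/
def seminorm : Seminorm ℂ (PreMaxTensor A B) := maxSeminorm A B

instance : NonUnitalSeminormedRing (PreMaxTensor A B) where
  __ := (inferInstance : NonUnitalRing (PreMaxTensor A B))
  __ := (seminorm A B).toAddGroupSeminorm.toSeminormedAddCommGroup
  norm_mul_le := (maxSeminorm_isCStar A B).mul_le

instance : NormedSpace ℂ (PreMaxTensor A B) where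
  __ := (inferInstance : Module ℂ (PreMaxTensor A B))
  norm_smul_le c x := (map_smul_eq_mul (maxSeminorm A B) c x).le

theorem norm_star_mul_self' (x : PreMaxTensor A B) : ‖star x * x‖ = ‖x‖ ^ 2 :=
  (maxSeminorm_isCStar A B).star_mul_self x

theorem norm_star' (x : PreMaxTensor A B) : ‖star x‖ = ‖x‖ :=
  (maxSeminorm_isCStar A B).star_eq x

instance : NormedStarGroup (PreMaxTensor A B) where
  norm_star_le x := (norm_star' A B x).le

variable {A B}

/-- The elementary tensor `a ⊗ b` in `A ⊙ B`. -/
def tmul (a : A) (b : B) : PreMaxTensor A B := a ⊗ₜ[ℂ] b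

theorem tmul_mul_tmul (a a' : A) (b b' : B) :
    tmul a b * tmul a' b' = tmul (a * a') (b * b') :=
  Algebra.TensorProduct.tmul_mul_tmul a a' b b'

theorem star_tmul (a : A) (b : B) : star (tmul a b) = tmul (star a) (star b) :=
  TensorProduct.star_tmul a b

theorem smul_tmul (c : ℂ) (a : A) (b : B) : c • tmul a b = tmul (c • a) b :=
  TensorProduct.smul_tmul' c a b

@[elab_as_elim]
theorem induction_on {p : PreMaxTensor A B → Prop} (t : PreMaxTensor A B) (zero : p 0)
    (tmul : ∀ a b, p (tmul a b)) (add : ∀ s t, p s → p t → p (s + t)) : p t :=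
  TensorProduct.induction_on t zero tmul add

end PreMaxTensor

/-- The maximal tensor product `A ⊗_max B`: the completion of `A ⊙ B` in the maximal
C*-seminorm. -/
def MaxTensor : Type _ := UniformSpace.Completion (PreMaxTensor A B)

namespace MaxTensor

instance : NormedAddCommGroup (MaxTensor A B) :=
  inferInstanceAs (NormedAddCommGroup (UniformSpace.Completion (PreMaxTensor A B)))
instance : NormedSpace ℂ (MaxTensor A B) :=
  inferInstanceAs (NormedSpace ℂ (UniformSpace.Completion (PreMaxTensor A B)))
instance : CompleteSpace (MaxTensor A B) :=
  inferInstanceAs (CompleteSpace (UniformSpace.Completion (PreMaxTensor A B)))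

variable {A B}

/-- The canonical map `A ⊙ B → A ⊗_max B`. -/
def of : PreMaxTensor A B →ₗᵢ[ℂ] MaxTensor A B := UniformSpace.Completion.toComplₗᵢ

/-- The elementary tensor `a ⊗ b` in `A ⊗_max B`. -/
def tmul (a : A) (b : B) : MaxTensor A B := of (PreMaxTensor.tmul a b)

theorem of_add (x y : PreMaxTensor A B) : of (x + y) = of x + of y := map_add _ _ _

theorem norm_of (t : PreMaxTensor A B) : ‖of t‖ = maxSeminorm A B t :=
  UniformSpace.Completion.norm_coe t

theorem isDenseInducing_of : IsDenseInducing (of : PreMaxTensor A B → MaxTensor A B) :=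
  UniformSpace.Completion.isDenseInducing_coe

theorem continuous_of : Continuous (of : PreMaxTensor A B → MaxTensor A B) :=
  UniformSpace.Completion.continuous_coe _

theorem isUniformInducing_of : IsUniformInducing (of : PreMaxTensor A B → MaxTensor A B) :=
  UniformSpace.Completion.isUniformInducing_coe _

@[elab_as_elim]
theorem induction_on {p : MaxTensor A B → Prop} (x : MaxTensor A B)
    (hp : IsClosed {x | p x}) (ih : ∀ t, p (of t)) : p x :=
  UniformSpace.Completion.induction_on x hp ih

instance : Mul (MaxTensor A B) where
  mul x y := (isDenseInducing_of.prodMap isDenseInducing_of).extend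
    (fun p : PreMaxTensor A B × PreMaxTensor A B => of (p.1 * p.2)) (x, y)

instance : Star (MaxTensor A B) where
  star := UniformSpace.Completion.map star

theorem of_mul (x y : PreMaxTensor A B) : of (x * y) = of x * of y :=
  ((isDenseInducing_of.prodMap isDenseInducing_of).extend_eq
    (f := fun p : PreMaxTensor A B × PreMaxTensor A B => of (p.1 * p.2))
    (continuous_of.comp continuous_mul) (x, y)).symm

theorem uniformContinuous_star : UniformContinuous (star : PreMaxTensor A B → PreMaxTensor A B) :=
  (starAddEquiv (R := PreMaxTensor A B)).toAddMonoidHom.uniformContinuous_of_continuousAt_zero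
    continuous_star.continuousAt

theorem of_star (x : PreMaxTensor A B) : of (star x) = star (of x) :=
  (UniformSpace.Completion.map_coe uniformContinuous_star x).symm

instance : ContinuousMul (MaxTensor A B) where
  continuous_mul := by
    let m : PreMaxTensor A B →+ PreMaxTensor A B →+ MaxTensor A B :=
      (AddMonoidHom.mul : PreMaxTensor A B →+ PreMaxTensor A B →+ PreMaxTensor A B).compr₂
        (of (A := A) (B := B)).toLinearMap.toAddMonoidHom
    have : Continuous fun p : PreMaxTensor A B × PreMaxTensor A B => m p.1 p.2 :=
      continuous_of.comp continuous_mul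
    have di : IsDenseInducing
      ((of (A := A) (B := B)).toLinearMap.toAddMonoidHom : PreMaxTensor A B → MaxTensor A B) :=
      isDenseInducing_of
    exact (di.extend_Z_bilin di this :)

instance : ContinuousStar (MaxTensor A B) where
  continuous_star := UniformSpace.Completion.continuous_map

theorem continuous_mulLeft (a : MaxTensor A B) : Continuous fun x => a * x :=
  continuous_mul.comp (continuous_const.prodMk continuous_id)

theorem continuous_mulRight (a : MaxTensor A B) : Continuous fun x => x * a :=
  continuous_mul.comp (continuous_id.prodMk continuous_const)

theorem left_distrib' (a b c : MaxTensor A B) : a * (b + c) = a * b + a * c := by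
  refine induction_on a (isClosed_eq (continuous_mulRight _)
    ((continuous_mulRight b).add (continuous_mulRight c))) fun a => ?_
  refine induction_on b (isClosed_eq ((continuous_mulLeft _).comp (continuous_add_const c))
    ((continuous_mulLeft _).add continuous_const)) fun b => ?_
  refine induction_on c (isClosed_eq ((continuous_mulLeft _).comp (continuous_const_add _))
    (continuous_const.add (continuous_mulLeft _))) fun c => ?_
  rw [← of_add, ← of_mul, ← of_mul, ← of_mul, ← of_add, mul_add]

theorem right_distrib' (a b c : MaxTensor A B) : (a + b) * c = a * c + b * c := by
  refine induction_on a (isClosed_eq ((continuous_mulRight c).comp (continuous_add_const b))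
    ((continuous_mulRight c).add continuous_const)) fun a => ?_
  refine induction_on b (isClosed_eq ((continuous_mulRight c).comp (continuous_const_add _))
    (continuous_const.add (continuous_mulRight c))) fun b => ?_
  refine induction_on c (isClosed_eq (continuous_mulLeft _)
    ((continuous_mulLeft _).add (continuous_mulLeft _))) fun c => ?_
  rw [← of_add, ← of_mul, ← of_mul, ← of_mul, ← of_add, add_mul]

theorem mul_assoc' (a b c : MaxTensor A B) : a * b * c = a * (b * c) := by
  refine induction_on a (isClosed_eq ((continuous_mulRight c).comp (continuous_mulRight b))
    (continuous_mulRight _)) fun a => ?_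
  refine induction_on b (isClosed_eq ((continuous_mulRight c).comp (continuous_mulLeft _))
    ((continuous_mulLeft _).comp (continuous_mulRight _))) fun b => ?_
  refine induction_on c (isClosed_eq (continuous_mulLeft _)
    ((continuous_mulLeft _).comp (continuous_mulLeft _))) fun c => ?_
  rw [← of_mul, ← of_mul, ← of_mul, ← of_mul, mul_assoc]

theorem zero_mul' (a : MaxTensor A B) : 0 * a = 0 := by
  refine induction_on a (isClosed_eq (continuous_mulLeft _) continuous_const) fun a => ?_
  rw [← map_zero (of (A := A) (B := B)), ← of_mul, zero_mul]

theorem mul_zero' (a : MaxTensor A B) : a * 0 = 0 := by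
  refine induction_on a (isClosed_eq (continuous_mulRight _) continuous_const) fun a => ?_
  rw [← map_zero (of (A := A) (B := B)), ← of_mul, mul_zero]

theorem norm_mul_le' (a b : MaxTensor A B) : ‖a * b‖ ≤ ‖a‖ * ‖b‖ := by
  refine induction_on a (isClosed_le (continuous_mulRight b).norm
    (continuous_norm.mul continuous_const)) fun a => ?_
  refine induction_on b (isClosed_le (continuous_mulLeft _).norm
    (continuous_const.mul continuous_norm)) fun b => ?_
  rw [← of_mul, norm_of, norm_of, norm_of]
  exact (maxSeminorm_isCStar A B).mul_le a b

instance : NonUnitalNormedRing (MaxTensor A B) where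
  __ := (inferInstance : NormedAddCommGroup (MaxTensor A B))
  mul := (· * ·)
  left_distrib := left_distrib'
  right_distrib := right_distrib'
  zero_mul := zero_mul'
  mul_zero := mul_zero'
  mul_assoc := mul_assoc'
  norm_mul_le := norm_mul_le'

instance : StarRing (MaxTensor A B) where
  star_involutive a := by
    refine induction_on a (isClosed_eq (continuous_star.comp continuous_star)
      continuous_id) fun a => ?_
    simp only [← of_star, star_star]
  star_mul a b := by
    refine induction_on a (isClosed_eq (continuous_star.comp (continuous_mulRight b))
      ((continuous_mulLeft _).comp continuous_star)) fun a => ?_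
    refine induction_on b (isClosed_eq (continuous_star.comp (continuous_mulLeft _))
      ((continuous_mulRight _).comp continuous_star)) fun b => ?_
    simp only [← of_star, ← of_mul, star_mul]
  star_add a b := by
    refine induction_on a (isClosed_eq (continuous_star.comp (continuous_add_const b))
      (continuous_star.add continuous_const)) fun a => ?_
    refine induction_on b (isClosed_eq (continuous_star.comp (continuous_const_add _))
      (continuous_const.add continuous_star)) fun b => ?_
    simp only [← of_star, ← map_add, star_add]

instance : CStarRing (MaxTensor A B) where
  norm_mul_self_le a := by
    refine induction_on a (isClosed_le (continuous_norm.mul continuous_norm)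
      (continuous_mul.comp (continuous_star.prodMk continuous_id)).norm) fun a => ?_
    rw [← of_star, ← of_mul, norm_of, norm_of, ← pow_two]
    exact ((maxSeminorm_isCStar A B).star_mul_self a).ge

theorem smul_mul' (c : ℂ) (a b : MaxTensor A B) : c • a * b = c • (a * b) := by
  refine induction_on a (isClosed_eq ((continuous_mulRight b).comp (continuous_const_smul c))
    ((continuous_const_smul c).comp (continuous_mulRight b))) fun a => ?_
  refine induction_on b (isClosed_eq (continuous_mulLeft _)
    ((continuous_const_smul c).comp (continuous_mulLeft _))) fun b => ?_
  rw [← map_smul, ← of_mul, ← of_mul, ← map_smul, smul_mul_assoc]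

theorem mul_smul' (c : ℂ) (a b : MaxTensor A B) : a * c • b = c • (a * b) := by
  refine induction_on a (isClosed_eq (continuous_mulRight _)
    ((continuous_const_smul c).comp (continuous_mulRight b))) fun a => ?_
  refine induction_on b (isClosed_eq ((continuous_mulLeft _).comp (continuous_const_smul c))
    ((continuous_const_smul c).comp (continuous_mulLeft _))) fun b => ?_
  rw [← map_smul, ← of_mul, ← of_mul, ← map_smul, mul_smul_comm]

theorem star_smul' (c : ℂ) (a : MaxTensor A B) : star (c • a) = star c • star a := by
  refine induction_on a (isClosed_eq (continuous_star.comp (continuous_const_smul c))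
    ((continuous_const_smul (star c)).comp continuous_star)) fun a => ?_
  rw [← map_smul, ← of_star, ← of_star, ← map_smul, star_smul]

instance : NonUnitalCStarAlgebra (MaxTensor A B) where
  __ := (inferInstance : NonUnitalNormedRing (MaxTensor A B))
  __ := (inferInstance : StarRing (MaxTensor A B))
  __ := (inferInstance : CStarRing (MaxTensor A B))
  __ := (inferInstance : CompleteSpace (MaxTensor A B))
  __ := (inferInstance : NormedSpace ℂ (MaxTensor A B))
  smul_assoc := smul_mul'
  smul_comm c a b := (mul_smul' c a b).symm
  star_smul := star_smul'

theorem tmul_mul_tmul (a a' : A) (b b' : B) :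
    tmul a b * tmul a' b' = tmul (a * a') (b * b') := by
  rw [tmul, tmul, tmul, ← of_mul, PreMaxTensor.tmul_mul_tmul]

theorem star_tmul (a : A) (b : B) : star (tmul a b) = tmul (star a) (star b) := by
  rw [tmul, tmul, ← of_star, PreMaxTensor.star_tmul]

theorem norm_tmul_le (a : A) (b : B) : ‖tmul a b‖ ≤ ‖a‖ * ‖b‖ :=
  (norm_of _).trans_le ((maxSeminorm_mem A B).2 a b)

end MaxTensor
end MaxTensor

namespace DoubleCentralizer

variable {A : Type*} [NonUnitalCStarAlgebra A]

theorem eq_of_forall_mul_right {u v : A} (h : ∀ w, u * w = v * w) : u = v := by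
  rw [← sub_eq_zero, ← CStarRing.mul_star_self_eq_zero_iff, sub_mul, h, sub_self]

theorem eq_of_forall_mul_left {u v : A} (h : ∀ w, w * u = w * v) : u = v := by
  rw [← sub_eq_zero, ← CStarRing.star_mul_self_eq_zero_iff, mul_sub, h, sub_self]

theorem snd_mul_apply (m : 𝓜(ℂ, A)) (x y : A) : m.snd (x * y) = x * m.snd y :=
  eq_of_forall_mul_right fun w => by rw [m.central, mul_assoc, mul_assoc, m.central]

theorem fst_mul_apply (m : 𝓜(ℂ, A)) (x y : A) : m.fst (x * y) = m.fst x * y :=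
  eq_of_forall_mul_left fun w => by rw [← m.central, ← mul_assoc, ← mul_assoc, m.central]

theorem snd_eq_star (m : 𝓜(ℂ, A)) (x : A) : m.snd x = star ((star m).fst (star x)) := by
  simp

theorem mem_center_of_fst_eq_snd {T : 𝓜(ℂ, A)} (h : ∀ x, T.fst x = T.snd x) :
    T ∈ Subalgebra.center ℂ 𝓜(ℂ, A) := by
  rw [Subalgebra.mem_center_iff]
  have key : ∀ (m : 𝓜(ℂ, A)) x, m.fst (T.fst x) = T.fst (m.fst x) := fun m x =>
    eq_of_forall_mul_left fun w => by
      rw [← m.central, h, ← snd_mul_apply, m.central, snd_mul_apply, h]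
  have key' : ∀ (m : 𝓜(ℂ, A)) x, m.snd (T.snd x) = T.snd (m.snd x) := fun m x => by
    have := key (star m) (star x)
    have hT : ∀ y, star (T.fst y) = (star T).snd (star y) := fun y => by simp
    rw [snd_eq_star m, ← h, ← h, ← star_star (T.fst (m.snd x)), snd_eq_star m]
    congr 1
    have h2 : ∀ y, star (T.fst y) = (star T).fst (star y) := fun y => by simp [h]
    have h3 : ∀ y, (star T).fst y = (star T).snd y := fun y => by simp [h]
    rw [h2, h2, star_star]
    refine eq_of_forall_mul_left fun w => ?_
    rw [← (star m).central, h3, ← snd_mul_apply, (star m).central, snd_mul_apply, h3]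
  intro m
  ext x
  · exact key m x
  · exact (key' m x).symm

theorem fst_eq_snd_of_mem_center {T : 𝓜(ℂ, A)} (h : T ∈ Subalgebra.center ℂ 𝓜(ℂ, A)) (x : A) :
    T.fst x = T.snd x := by
  rw [Subalgebra.mem_center_iff] at h
  refine eq_of_forall_mul_right fun w => ?_
  have := congrArg (fun m : 𝓜(ℂ, A) => m.fst w) (h (DoubleCentralizer.coe ℂ x))
  simp only [mul_fst, coe_fst] at this
  change x * T.fst w = T.fst (x * w) at this
  rw [T.central, this, fst_mul_apply]

end DoubleCentralizer

namespace ClosedIdeal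

variable {A : Type*} [NonUnitalCStarAlgebra A] (I : ClosedIdeal A)

theorem fst_mem (m : 𝓜(ℂ, A)) {x : A} (hx : x ∈ I.toSubmodule) : m.fst x ∈ I.toSubmodule := by
  have hcl : x ∈ closure {y | m.fst y ∈ I.toSubmodule} := by
    rw [Metric.mem_closure_iff]
    intro ε hε
    obtain ⟨e, he, -, h, -⟩ := I.exists_approx hx hε
    refine ⟨x * e, ?_, by rwa [dist_eq_norm]⟩
    rw [Set.mem_ofPred_eq, DoubleCentralizer.fst_mul_apply]
    exact I.mul_mem_left' _ he
  have : IsClosed {y | m.fst y ∈ I.toSubmodule} := I.isClosed'.preimage m.fst.continuous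
  rwa [this.closure_eq] at hcl

theorem snd_mem (m : 𝓜(ℂ, A)) {x : A} (hx : x ∈ I.toSubmodule) : m.snd x ∈ I.toSubmodule := by
  rw [DoubleCentralizer.snd_eq_star]
  exact I.star_mem' (I.fst_mem _ (I.star_mem' hx))

/-- The operator induced on `A / I` by an operator on `A` which maps `I` to itself. -/
def mapQuot (T : A →L[ℂ] A) (hT : ∀ x ∈ I.toSubmodule, T x ∈ I.toSubmodule) :
    I.Quot →L[ℂ] I.Quot :=
  LinearMap.mkContinuous (I.toSubmodule.mapQ I.toSubmodule (T : A →ₗ[ℂ] A) hT :) ‖T‖ <| by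
    intro z
    refine le_of_forall_pos_le_add fun ε hε => ?_
    have hε' : 0 < ε / (‖T‖ + 1) := by positivity
    obtain ⟨x, rfl, hx⟩ := I.exists_norm_lt z hε'
    refine (I.norm_proj_le (T x)).trans ((T.le_opNorm x).trans ?_)
    have h1 : ‖T‖ * ‖x‖ ≤ ‖T‖ * (‖I.proj x‖ + ε / (‖T‖ + 1)) := by gcongr
    have h2 : ‖T‖ * (ε / (‖T‖ + 1)) ≤ ε := by
      rw [mul_div_assoc', div_le_iff₀ (by positivity)]
      nlinarith [norm_nonneg T]
    linarith [mul_add ‖T‖ ‖I.proj x‖ (ε / (‖T‖ + 1))]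

theorem mapQuot_proj (T : A →L[ℂ] A) (hT : ∀ x ∈ I.toSubmodule, T x ∈ I.toSubmodule) (x : A) :
    I.mapQuot T hT (I.proj x) = I.proj (T x) := rfl

/-- The multiplier of `A / I` induced by a multiplier of `A`. -/
def quotMultiplier : 𝓜(ℂ, A) →⋆ₙₐ[ℂ] 𝓜(ℂ, I.Quot) where
  toFun m :=
    { fst := I.mapQuot m.fst fun _ => I.fst_mem m
      snd := I.mapQuot m.snd fun _ => I.snd_mem m
      central := fun x y => by
        obtain ⟨x, rfl⟩ := proj_surjective x
        obtain ⟨y, rfl⟩ := proj_surjective y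
        simp only [mapQuot_proj, ← proj_mul, m.central] }
  map_smul' c m := by
    ext x <;> obtain ⟨x, rfl⟩ := proj_surjective x <;> simp [mapQuot_proj]
  map_zero' := by
    ext x <;> obtain ⟨x, rfl⟩ := proj_surjective x <;> simp [mapQuot_proj]
  map_add' m n := by
    ext x <;> obtain ⟨x, rfl⟩ := proj_surjective x <;> simp [mapQuot_proj]
  map_mul' m n := by
    ext x <;> obtain ⟨x, rfl⟩ := proj_surjective x <;> simp [mapQuot_proj]
  map_star' m := by
    ext x <;> obtain ⟨x, rfl⟩ := proj_surjective x <;> simp [mapQuot_proj, ← proj_star]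

theorem quotMultiplier_fst (m : 𝓜(ℂ, A)) (x : A) :
    (I.quotMultiplier m).fst (I.proj x) = I.proj (m.fst x) := rfl

theorem quotMultiplier_snd (m : 𝓜(ℂ, A)) (x : A) :
    (I.quotMultiplier m).snd (I.proj x) = I.proj (m.snd x) := rfl

/-- The closed ideal generated by a set. -/
def generate (S : Set A) : ClosedIdeal A where
  carrier := {x | ∀ J : ClosedIdeal A, S ⊆ J.carrier → x ∈ J.carrier}
  add_mem' hx hy J hJ := J.add_mem' (hx J hJ) (hy J hJ)
  zero_mem' J _ := J.zero_mem'
  smul_mem' c _ hx J hJ := J.smul_mem' c (hx J hJ)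
  mul_mem_left' a _ hx J hJ := J.mul_mem_left' a (hx J hJ)
  mul_mem_right' a _ hx J hJ := J.mul_mem_right' a (hx J hJ)
  star_mem' hx J hJ := J.star_mem' (hx J hJ)
  isClosed' := by
    simp only [Set.ofPred_forall]
    exact isClosed_iInter fun J => isClosed_iInter fun _ => J.isClosed'

end ClosedIdeal

namespace MaxTensor

variable {A B : Type*} [NonUnitalCStarAlgebra A] [NonUnitalCStarAlgebra B]

/-- The operator `id ⊗ T` on `A ⊙ B`. -/
def preMap (T : B →ₗ[ℂ] B) : PreMaxTensor A B →ₗ[ℂ] PreMaxTensor A B :=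
  (TensorProduct.map LinearMap.id T : A ⊗[ℂ] B →ₗ[ℂ] A ⊗[ℂ] B)

theorem preMap_tmul (T : B →ₗ[ℂ] B) (a : A) (b : B) :
    preMap T (PreMaxTensor.tmul a b) = PreMaxTensor.tmul a (T b) := rfl

theorem star_preMap_mul_preMap {u : 𝓜(ℂ, B)} (hu : star u * u = 1) (s t : PreMaxTensor A B) :
    star (preMap (u.fst : B →ₗ[ℂ] B) s) * preMap (u.fst : B →ₗ[ℂ] B) t = star s * t := by
  induction s using PreMaxTensor.induction_on with
  | zero => simp
  | add x y hx hy => simp only [map_add, star_add, add_mul, hx, hy]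
  | tmul a b =>
    induction t using PreMaxTensor.induction_on with
    | zero => simp
    | add x y hx hy => simp only [map_add, mul_add, hx, hy]
    | tmul c d =>
      rw [preMap_tmul, preMap_tmul, PreMaxTensor.star_tmul, PreMaxTensor.star_tmul,
        PreMaxTensor.tmul_mul_tmul, PreMaxTensor.tmul_mul_tmul]
      congr 1
      have h1 : star (u.fst b) = (star u).snd (star b) := by simp
      have h2 : (star u).fst (u.fst d) = d := congrArg (fun m : 𝓜(ℂ, B) => m.fst d) hu
      change star (u.fst b) * u.fst d = _
      rw [h1, (star u).central, h2]

theorem norm_preMap_unitary {u : 𝓜(ℂ, B)} (hu : star u * u = 1) (t : PreMaxTensor A B) :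
    ‖preMap (u.fst : B →ₗ[ℂ] B) t‖ = ‖t‖ := by
  have h := star_preMap_mul_preMap hu t t
  have h1 := PreMaxTensor.norm_star_mul_self' A B (preMap (u.fst : B →ₗ[ℂ] B) t)
  rw [h, PreMaxTensor.norm_star_mul_self'] at h1
  exact ((sq_eq_sq₀ (norm_nonneg _) (norm_nonneg _)).1 h1).symm

theorem preMap_add (S T : B →ₗ[ℂ] B) (t : PreMaxTensor A B) :
    preMap (S + T) t = preMap S t + preMap T t :=
  LinearMap.congr_fun (TensorProduct.map_add_right (LinearMap.id : A →ₗ[ℂ] A) S T) t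

theorem preMap_smul (c : ℂ) (T : B →ₗ[ℂ] B) (t : PreMaxTensor A B) :
    preMap (c • T) t = c • preMap T t :=
  LinearMap.congr_fun (TensorProduct.map_smul_right c (LinearMap.id : A →ₗ[ℂ] A) T) t

theorem exists_sum_four_isometries (m : 𝓜(ℂ, B)) : ∃ (u : Fin 4 → 𝓜(ℂ, B)) (c : Fin 4 → ℂ),
    (∀ i, star (u i) * u i = 1) ∧
      (m.fst : B →ₗ[ℂ] B) = ∑ i, c i • ((u i).fst : B →ₗ[ℂ] B) := by
  obtain ⟨u, c, hm, -⟩ := CStarAlgebra.exists_sum_four_unitary m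
  refine ⟨fun i => u i, c, fun i => (Unitary.mem_iff.1 (u i).2).1, ?_⟩
  rw [hm, Fin.sum_univ_four, Fin.sum_univ_four]
  rfl

theorem norm_smul_preMap_le (c : ℂ) {u : 𝓜(ℂ, B)} (hu : star u * u = 1) (t : PreMaxTensor A B) :
    ‖c • preMap (u.fst : B →ₗ[ℂ] B) t‖ ≤ ‖c‖ * ‖t‖ :=
  (norm_smul_le _ _).trans_eq (congrArg (‖c‖ * ·) (norm_preMap_unitary hu t))

theorem preMap_fst_bound (m : 𝓜(ℂ, B)) :
    ∃ C, ∀ t : PreMaxTensor A B, ‖preMap (m.fst : B →ₗ[ℂ] B) t‖ ≤ C * ‖t‖ := by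
  obtain ⟨u, c, hu, h⟩ := exists_sum_four_isometries m
  refine ⟨‖c 0‖ + ‖c 1‖ + ‖c 2‖ + ‖c 3‖, fun t => ?_⟩
  rw [h, Fin.sum_univ_four, preMap_add, preMap_add, preMap_add, preMap_smul, preMap_smul,
    preMap_smul, preMap_smul, add_mul, add_mul, add_mul]
  refine (norm_add_le _ _).trans (add_le_add ?_ (norm_smul_preMap_le _ (hu 3) t))
  refine (norm_add_le _ _).trans (add_le_add ?_ (norm_smul_preMap_le _ (hu 2) t))
  exact (norm_add_le _ _).trans
    (add_le_add (norm_smul_preMap_le _ (hu 0) t) (norm_smul_preMap_le _ (hu 1) t))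

theorem preMap_snd_eq (m : 𝓜(ℂ, B)) (t : PreMaxTensor A B) :
    preMap (m.snd : B →ₗ[ℂ] B) t = star (preMap ((star m).fst : B →ₗ[ℂ] B) (star t)) := by
  induction t using PreMaxTensor.induction_on with
  | zero => simp
  | add x y hx hy => simp only [map_add, star_add, hx, hy]
  | tmul a b =>
    rw [preMap_tmul, PreMaxTensor.star_tmul, preMap_tmul, PreMaxTensor.star_tmul, star_star]
    congr 1
    exact DoubleCentralizer.snd_eq_star m b

theorem preMap_snd_bound (m : 𝓜(ℂ, B)) :
    ∃ C, ∀ t : PreMaxTensor A B, ‖preMap (m.snd : B →ₗ[ℂ] B) t‖ ≤ C * ‖t‖ := by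
  obtain ⟨C, hC⟩ := preMap_fst_bound (A := A) (star m)
  refine ⟨C, fun t => ?_⟩
  rw [preMap_snd_eq, PreMaxTensor.norm_star']
  exact (hC _).trans_eq (by rw [PreMaxTensor.norm_star'])

/-- The extension to `A ⊗_max B` of a bounded operator defined on `A ⊙ B`. -/
def extend (S : PreMaxTensor A B →L[ℂ] MaxTensor A B) : MaxTensor A B →L[ℂ] MaxTensor A B :=
  S.extend of.toContinuousLinearMap

theorem extend_of (S : PreMaxTensor A B →L[ℂ] MaxTensor A B) (t : PreMaxTensor A B) :
    extend S (of t) = S t :=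
  ContinuousLinearMap.extend_eq S (e := of.toContinuousLinearMap)
    isDenseInducing_of.dense isUniformInducing_of t

/-- The extension of `id ⊗ T` to `A ⊗_max B`, for `T` such that `id ⊗ T` is bounded. -/
def map (T : B →ₗ[ℂ] B) (hT : ∃ C, ∀ t : PreMaxTensor A B, ‖preMap T t‖ ≤ C * ‖t‖) :
    MaxTensor A B →L[ℂ] MaxTensor A B :=
  extend (of.toContinuousLinearMap ∘L (preMap T).mkContinuousOfExistsBound hT)

theorem map_of (T : B →ₗ[ℂ] B) (hT : ∃ C, ∀ t : PreMaxTensor A B, ‖preMap T t‖ ≤ C * ‖t‖)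
    (t : PreMaxTensor A B) : map T hT (of t) = of (preMap T t) :=
  extend_of _ t

theorem map_tmul (T : B →ₗ[ℂ] B) (hT : ∃ C, ∀ t : PreMaxTensor A B, ‖preMap T t‖ ≤ C * ‖t‖)
    (a : A) (b : B) : map T hT (tmul a b) = tmul a (T b) :=
  map_of T hT _

theorem dense_span_tmul :
    (Submodule.span ℂ {z : MaxTensor A B | ∃ a b, tmul a b = z}).topologicalClosure = ⊤ := by
  rw [eq_top_iff]
  rintro z -
  refine induction_on z (Submodule.isClosed_topologicalClosure _) fun t => ?_
  apply Submodule.le_topologicalClosure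
  induction t using PreMaxTensor.induction_on with
  | zero => rw [map_zero]; exact zero_mem _
  | add x y hx hy => rw [map_add]; exact add_mem hx hy
  | tmul a b => exact Submodule.subset_span ⟨a, b, rfl⟩

theorem clm_ext {E : Type*} [NormedAddCommGroup E] [NormedSpace ℂ E]
    {S T : MaxTensor A B →L[ℂ] E} (h : ∀ a b, S (tmul a b) = T (tmul a b)) : S = T := by
  refine ContinuousLinearMap.ext_on (s := {z : MaxTensor A B | ∃ a b, tmul a b = z}) ?_ ?_
  · rw [Submodule.dense_iff_topologicalClosure_eq_top]; exact dense_span_tmul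
  · rintro _ ⟨a, b, rfl⟩; exact h a b

theorem tmul_add (a : A) (b c : B) : tmul a (b + c) = tmul a b + tmul a c := by
  rw [tmul, tmul, tmul, ← of_add]
  exact congrArg of (TensorProduct.tmul_add a b c)

theorem tmul_smul (c : ℂ) (a : A) (b : B) : tmul a (c • b) = c • tmul a b := by
  rw [tmul, tmul, ← map_smul]
  exact congrArg of (TensorProduct.tmul_smul c a b)

theorem tmul_zero (a : A) : tmul a (0 : B) = 0 := by
  rw [tmul, ← map_zero (of (A := A) (B := B))]
  exact congrArg of (TensorProduct.tmul_zero B a)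

theorem continuous_tmul (a : A) : Continuous fun b : B => tmul a b := by
  let g : B →+ MaxTensor A B :=
    { toFun := tmul a, map_zero' := tmul_zero a, map_add' := tmul_add a }
  exact AddMonoidHomClass.continuous_of_bound g ‖a‖ (norm_tmul_le a)

/-- The multiplier `1 ⊗ m` of `A ⊗_max B`, for a multiplier `m` of `B`. -/
def toMultiplier (m : 𝓜(ℂ, B)) : 𝓜(ℂ, MaxTensor A B) where
  fst := map (m.fst : B →ₗ[ℂ] B) (preMap_fst_bound m)
  snd := map (m.snd : B →ₗ[ℂ] B) (preMap_snd_bound m)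
  central := fun x y => by
    refine induction_on x (isClosed_eq ((continuous_mulRight _).comp
      (ContinuousLinearMap.continuous _)) (continuous_mulRight _)) fun x => ?_
    refine induction_on y (isClosed_eq (continuous_mulLeft _)
      ((continuous_mulLeft _).comp (ContinuousLinearMap.continuous _))) fun y => ?_
    rw [map_of, map_of, ← of_mul, ← of_mul]
    congr 1
    induction x using PreMaxTensor.induction_on with
    | zero => simp
    | add x y hx hy => simp only [map_add, add_mul, hx, hy]
    | tmul a b =>
      induction y using PreMaxTensor.induction_on with
      | zero => simp
      | add x y hx hy => simp only [map_add, mul_add, hx, hy]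
      | tmul c d =>
        rw [preMap_tmul, preMap_tmul, PreMaxTensor.tmul_mul_tmul, PreMaxTensor.tmul_mul_tmul]
        congr 1
        exact m.central b d

theorem toMultiplier_fst_tmul (m : 𝓜(ℂ, B)) (a : A) (b : B) :
    (toMultiplier m).fst (tmul a b) = tmul a (m.fst b) := map_tmul _ _ a b

theorem toMultiplier_snd_tmul (m : 𝓜(ℂ, B)) (a : A) (b : B) :
    (toMultiplier m).snd (tmul a b) = tmul a (m.snd b) := map_tmul _ _ a b

theorem multiplier_ext {m n : 𝓜(ℂ, MaxTensor A B)}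
    (h₁ : ∀ a b, m.fst (tmul a b) = n.fst (tmul a b))
    (h₂ : ∀ a b, m.snd (tmul a b) = n.snd (tmul a b)) : m = n :=
  DoubleCentralizer.ext _ _ _ _ (Prod.ext (clm_ext h₁) (clm_ext h₂))

/-- The *-homomorphism `m ↦ 1 ⊗ m` from the multipliers of `B` to those of `A ⊗_max B`. -/
def multiplier : 𝓜(ℂ, B) →⋆ₙₐ[ℂ] 𝓜(ℂ, MaxTensor A B) where
  toFun := toMultiplier
  map_smul' c m := by
    refine multiplier_ext (fun a b => ?_) (fun a b => ?_)
    · rw [toMultiplier_fst_tmul]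
      exact (tmul_smul _ _ _).trans (congrArg (c • ·) (toMultiplier_fst_tmul m a b).symm)
    · rw [toMultiplier_snd_tmul]
      exact (tmul_smul _ _ _).trans (congrArg (c • ·) (toMultiplier_snd_tmul m a b).symm)
  map_zero' := by
    refine multiplier_ext (fun a b => ?_) (fun a b => ?_)
    · rw [toMultiplier_fst_tmul]; exact tmul_zero a
    · rw [toMultiplier_snd_tmul]; exact tmul_zero a
  map_add' m n := by
    refine multiplier_ext (fun a b => ?_) (fun a b => ?_)
    · rw [toMultiplier_fst_tmul]
      exact (tmul_add _ _ _).trans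
        (congrArg₂ (· + ·) (toMultiplier_fst_tmul m a b).symm (toMultiplier_fst_tmul n a b).symm)
    · rw [toMultiplier_snd_tmul]
      exact (tmul_add _ _ _).trans
        (congrArg₂ (· + ·) (toMultiplier_snd_tmul m a b).symm (toMultiplier_snd_tmul n a b).symm)
  map_mul' m n := by
    refine multiplier_ext (fun a b => ?_) (fun a b => ?_)
    · rw [toMultiplier_fst_tmul, DoubleCentralizer.mul_fst, DoubleCentralizer.mul_fst]
      change _ = (toMultiplier m).fst ((toMultiplier n).fst (tmul a b))
      rw [toMultiplier_fst_tmul, toMultiplier_fst_tmul]; rfl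
    · rw [toMultiplier_snd_tmul, DoubleCentralizer.mul_snd, DoubleCentralizer.mul_snd]
      change _ = (toMultiplier n).snd ((toMultiplier m).snd (tmul a b))
      rw [toMultiplier_snd_tmul, toMultiplier_snd_tmul]; rfl
  map_star' m := by
    refine multiplier_ext (fun a b => ?_) (fun a b => ?_)
    · rw [toMultiplier_fst_tmul, DoubleCentralizer.star_fst, DoubleCentralizer.star_fst,
        star_tmul, toMultiplier_snd_tmul, star_tmul, star_star]
    · rw [toMultiplier_snd_tmul, DoubleCentralizer.star_snd, DoubleCentralizer.star_snd,
        star_tmul, toMultiplier_fst_tmul, star_tmul, star_star]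

theorem multiplier_fst_tmul (m : 𝓜(ℂ, B)) (a : A) (b : B) :
    (multiplier m).fst (tmul a b) = tmul a (m.fst b) := toMultiplier_fst_tmul m a b

theorem multiplier_snd_tmul (m : 𝓜(ℂ, B)) (a : A) (b : B) :
    (multiplier m).snd (tmul a b) = tmul a (m.snd b) := toMultiplier_snd_tmul m a b

end MaxTensor

theorem map_mem_of_mem_closedSpan {E F : Type*} [NormedAddCommGroup E] [NormedSpace ℂ E]
    [NormedAddCommGroup F] [NormedSpace ℂ F] {S : Set E} {P : Submodule ℂ F}
    (hP : IsClosed (P : Set F)) {g : E → F} (hg : Continuous g) (h0 : g 0 = 0)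
    (hadd : ∀ x y, g (x + y) = g x + g y) (hsmul : ∀ (c : ℂ) x, g x ∈ P → g (c • x) ∈ P)
    (hS : ∀ x ∈ S, g x ∈ P) {x : E} (hx : x ∈ (Submodule.span ℂ S).topologicalClosure) :
    g x ∈ P := by
  have h1 : (Submodule.span ℂ S : Set E) ⊆ g ⁻¹' P := by
    intro y hy
    induction hy using Submodule.span_induction with
    | mem y hy => exact hS y hy
    | zero => change g 0 ∈ P; rw [h0]; exact P.zero_mem
    | add y z _ _ hy hz => change g (y + z) ∈ P; rw [hadd]; exact P.add_mem hy hz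
    | smul c y _ hy => exact hsmul c y hy
  exact closure_minimal h1 (hP.preimage hg) hx

/-- A `C₀(X)`-algebra structure on a C*-algebra `A`: a *-homomorphism `θ` from `C₀(X)` into the
center of the multiplier algebra of `A` such that `θ(C₀(X)) A = A` (that is, the products
`θ(f) a` span a dense subspace of `A`). -/
structure C0Algebra (X A : Type*) [TopologicalSpace X] [NonUnitalCStarAlgebra A] where
  θ : C₀(X, ℂ) →⋆ₙₐ[ℂ] 𝓜(ℂ, A)
  mem_center : ∀ f, θ f ∈ Subalgebra.center ℂ 𝓜(ℂ, A)
  nondegenerate :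
    (Submodule.span ℂ {z : A | ∃ f a, (θ f).fst a = z}).topologicalClosure = ⊤

namespace C0Algebra

section Basic

variable {X A B : Type*} [TopologicalSpace X] [NonUnitalCStarAlgebra A] [NonUnitalCStarAlgebra B]

/-- The product `f a = θ(f) a` for `f ∈ C₀(X)` and `a ∈ A`. -/
def act (α : C0Algebra X A) (f : C₀(X, ℂ)) (a : A) : A := (α.θ f).fst a

variable (α : C0Algebra X A)

theorem snd_eq_act (f : C₀(X, ℂ)) (a : A) : (α.θ f).snd a = α.act f a :=
  (DoubleCentralizer.fst_eq_snd_of_mem_center (α.mem_center f) a).symm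

theorem act_mul (f : C₀(X, ℂ)) (a b : A) : α.act f (a * b) = α.act f a * b :=
  DoubleCentralizer.fst_mul_apply _ _ _

theorem mul_act (f : C₀(X, ℂ)) (a b : A) : a * α.act f b = α.act f (a * b) := by
  rw [← snd_eq_act, ← snd_eq_act, DoubleCentralizer.snd_mul_apply]

theorem star_act (f : C₀(X, ℂ)) (a : A) : star (α.act f a) = α.act (star f) (star a) := by
  have h : α.θ (star f) = star (α.θ f) := map_star α.θ f
  rw [← snd_eq_act α (star f), h, DoubleCentralizer.star_snd, star_star]
  rfl

/-- The quotient of a `C₀(X)`-algebra by a closed ideal, as a `C₀(X)`-algebra. -/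
def quotient (J : ClosedIdeal A) : C0Algebra X J.Quot where
  θ := J.quotMultiplier.comp α.θ
  mem_center f := DoubleCentralizer.mem_center_of_fst_eq_snd fun z => by
    obtain ⟨a, rfl⟩ := ClosedIdeal.proj_surjective z
    exact congrArg J.proj (DoubleCentralizer.fst_eq_snd_of_mem_center (α.mem_center f) a)
  nondegenerate := by
    rw [eq_top_iff]
    rintro z -
    obtain ⟨a, rfl⟩ := ClosedIdeal.proj_surjective z
    have ha : a ∈ (Submodule.span ℂ {z : A | ∃ f a, (α.θ f).fst a = z}).topologicalClosure := by
      rw [α.nondegenerate]; trivial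
    refine map_mem_of_mem_closedSpan (Submodule.isClosed_topologicalClosure _) J.continuous_proj
      (map_zero _) (map_add _) (fun c x hx => ?_) ?_ ha
    · rw [map_smul]; exact Submodule.smul_mem _ _ hx
    · rintro _ ⟨f, a, rfl⟩
      exact Submodule.le_topologicalClosure _ (Submodule.subset_span ⟨f, J.proj a, rfl⟩)

/-- The `C₀(X)`-algebra `D ⊗_max B` for a C*-algebra `D` and a `C₀(X)`-algebra `B`, with
`f (d ⊗ b) = d ⊗ f b`. -/
def tensor (D : Type*) [NonUnitalCStarAlgebra D] (β : C0Algebra X B) :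
    C0Algebra X (MaxTensor D B) where
  θ := MaxTensor.multiplier.comp β.θ
  mem_center f := DoubleCentralizer.mem_center_of_fst_eq_snd fun z => by
    have key : (MaxTensor.multiplier (A := D) (β.θ f)).fst =
        (MaxTensor.multiplier (A := D) (β.θ f)).snd := MaxTensor.clm_ext fun a b => by
      rw [MaxTensor.multiplier_fst_tmul, MaxTensor.multiplier_snd_tmul,
        DoubleCentralizer.fst_eq_snd_of_mem_center (β.mem_center f)]
    change (MaxTensor.multiplier (A := D) (β.θ f)).fst z = _
    rw [key]
    rfl
  nondegenerate := by
    rw [eq_top_iff, ← MaxTensor.dense_span_tmul]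
    refine Submodule.topologicalClosure_minimal _ ?_ (Submodule.isClosed_topologicalClosure _)
    rw [Submodule.span_le]
    rintro _ ⟨d, b, rfl⟩
    have hb : b ∈ (Submodule.span ℂ {z : B | ∃ f b, (β.θ f).fst b = z}).topologicalClosure := by
      rw [β.nondegenerate]; trivial
    refine map_mem_of_mem_closedSpan (Submodule.isClosed_topologicalClosure _)
      (MaxTensor.continuous_tmul d) (MaxTensor.tmul_zero d) (MaxTensor.tmul_add d)
      (fun c x hx => ?_) ?_ hb
    · rw [MaxTensor.tmul_smul]; exact Submodule.smul_mem _ _ hx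
    · rintro _ ⟨f, b, rfl⟩
      exact Submodule.le_topologicalClosure _
        (Submodule.subset_span ⟨f, MaxTensor.tmul d b, MaxTensor.multiplier_fst_tmul _ _ _⟩)

/-- The closed ideal `I_x A` of `A`, where `I_x = {f ∈ C₀(X) : f(x) = 0}`. -/
def fiberIdeal (x : X) : ClosedIdeal A where
  __ := (Submodule.span ℂ
    {z : A | ∃ (f : C₀(X, ℂ)) (a : A), f x = 0 ∧ α.act f a = z}).topologicalClosure
  mul_mem_left' b := fun {z} hz => by
    refine map_mem_of_mem_closedSpan (Submodule.isClosed_topologicalClosure _) (g := fun z => b * z)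
      (by fun_prop) (by simp) (by simp [mul_add]) (fun c x hx => ?_) ?_ hz
    · rw [mul_smul_comm]; exact Submodule.smul_mem _ _ hx
    · rintro _ ⟨f, a, hf, rfl⟩
      exact Submodule.le_topologicalClosure _ (Submodule.subset_span ⟨f, b * a, hf, (α.mul_act f b a).symm⟩)
  mul_mem_right' b := fun {z} hz => by
    refine map_mem_of_mem_closedSpan (Submodule.isClosed_topologicalClosure _) (g := fun z => z * b)
      (by fun_prop) (by simp) (by simp [add_mul]) (fun c x hx => ?_) ?_ hz
    · rw [smul_mul_assoc]; exact Submodule.smul_mem _ _ hx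
    · rintro _ ⟨f, a, hf, rfl⟩
      exact Submodule.le_topologicalClosure _ (Submodule.subset_span ⟨f, a * b, hf, α.act_mul f a b⟩)
  star_mem' := fun {z} hz => by
    refine map_mem_of_mem_closedSpan (Submodule.isClosed_topologicalClosure _) (g := star)
      (by fun_prop) (by simp) (by simp) (fun c x hx => ?_) ?_ hz
    · rw [star_smul]; exact Submodule.smul_mem _ _ hx
    · rintro _ ⟨f, a, hf, rfl⟩
      exact Submodule.le_topologicalClosure _ (Submodule.subset_span ⟨star f, star a, by simp [hf], (α.star_act f a).symm⟩)
  isClosed' := Submodule.isClosed_topologicalClosure _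

/-- The fiber `A_x = A / I_x A`. -/
abbrev Fiber (x : X) : Type _ := (α.fiberIdeal x).Quot

/-- The image `a_x` of `a ∈ A` in `A_x`. -/
def eval (a : A) (x : X) : α.Fiber x := (α.fiberIdeal x).proj a

/-- The bundle `A^♯`, the disjoint union of the fibers `A_x`. -/
structure Bundle where
  base : X
  val : α.Fiber base

/-- The basic set `U(a, ε) = {b_x : x ∈ U, ‖b_x - a_x‖ < ε}`. -/
def basicSet (U : Set X) (a : A) (ε : ℝ) : Set α.Bundle :=
  {z | z.base ∈ U ∧ ‖z.val - α.eval a z.base‖ < ε}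

/-- The topology of `A^♯`, generated by the sets `U(a, ε)` with `U` open and `ε > 0`. -/
instance : TopologicalSpace α.Bundle :=
  TopologicalSpace.generateFrom
    {W | ∃ (U : Set X) (a : A) (ε : ℝ), IsOpen U ∧ 0 < ε ∧ W = α.basicSet U a ε}

/-- The closed ideal of `A ⊗_max B` generated by the differences `f a ⊗ b - a ⊗ f b`. -/
def balancedIdeal (β : C0Algebra X B) : ClosedIdeal (MaxTensor A B) :=
  ClosedIdeal.generate {z | ∃ (f : C₀(X, ℂ)) (a : A) (b : B),
    z = MaxTensor.tmul (α.act f a) b - MaxTensor.tmul a (β.act f b)}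

/-- The maximal balanced tensor product `A ⊗_{C₀(X)} B`. -/
abbrev BalancedTensor (β : C0Algebra X B) : Type _ := (α.balancedIdeal β).Quot

/-- The elementary tensor `a ⊗ b` in `A ⊗_{C₀(X)} B`. -/
def tmul (β : C0Algebra X B) (a : A) (b : B) : α.BalancedTensor β :=
  (α.balancedIdeal β).proj (MaxTensor.tmul a b)

end Basic

section Pullback

variable {X Y A : Type*} [TopologicalSpace X] [TopologicalSpace Y] [NonUnitalCStarAlgebra A]

/-- The function `y ↦ f(q(y)) F(y)` in `C₀(Y)`. -/
def compMul (q : C(Y, X)) (f : C₀(X, ℂ)) (F : C₀(Y, ℂ)) : C₀(Y, ℂ) where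
  toFun y := f (q y) * F y
  continuous_toFun := by fun_prop
  zero_at_infty' := by
    refine squeeze_zero_norm (a := fun y => ‖f‖ * ‖F y‖) (fun y => ?_) ?_
    · rw [norm_mul]
      gcongr
      exact f.toBCF.norm_coe_le_norm (q y)
    · simpa using (zero_at_infty F).norm.const_mul ‖f‖

@[simp]
theorem compMul_apply (q : C(Y, X)) (f : C₀(X, ℂ)) (F : C₀(Y, ℂ)) (y : Y) :
    compMul q f F y = f (q y) * F y := rfl

theorem norm_compMul_le (q : C(Y, X)) (f : C₀(X, ℂ)) (F : C₀(Y, ℂ)) :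
    ‖compMul q f F‖ ≤ ‖f‖ * ‖F‖ := by
  rw [← ZeroAtInftyContinuousMap.norm_toBCF_eq_norm (f := compMul q f F),
    BoundedContinuousFunction.norm_le (by positivity)]
  intro y
  change ‖f (q y) * F y‖ ≤ _
  rw [norm_mul]
  gcongr
  · exact f.toBCF.norm_coe_le_norm (q y)
  · exact F.toBCF.norm_coe_le_norm y

/-- Multiplication by `f ∘ q`, as an operator on `C₀(Y)`. -/
def compMulL (q : C(Y, X)) (f : C₀(X, ℂ)) : C₀(Y, ℂ) →L[ℂ] C₀(Y, ℂ) :=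
  LinearMap.mkContinuous
    { toFun := compMul q f
      map_add' := fun F G => by ext y; simp [mul_add]
      map_smul' := fun c F => by ext y; simp [mul_left_comm] }
    ‖f‖ (norm_compMul_le q f)

@[simp]
theorem compMulL_apply (q : C(Y, X)) (f : C₀(X, ℂ)) (F : C₀(Y, ℂ)) (y : Y) :
    compMulL q f F y = f (q y) * F y := rfl

variable [LocallyCompactSpace X] [T2Space X]

/-- The `C₀(X)`-algebra structure on `C₀(Y)` given by a continuous map `q : Y → X`, for which
`(f F)(y) = f(q(y)) F(y)`. -/
def ofMap (q : C(Y, X)) : C0Algebra X C₀(Y, ℂ) where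
  θ :=
    { toFun := fun f =>
        { fst := compMulL q f
          snd := compMulL q f
          central := fun F G => by ext y; simp [mul_assoc, mul_left_comm] }
      map_smul' := fun c f => by ext F y <;> simp [mul_assoc]
      map_zero' := by ext F y <;> simp
      map_add' := fun f g => by ext F y <;> simp [add_mul]
      map_mul' := fun f g => by ext F y <;> simp [mul_assoc, mul_left_comm]
      map_star' := fun f => by ext F y <;> simp }
  mem_center f := DoubleCentralizer.mem_center_of_fst_eq_snd fun _ => rfl
  nondegenerate := by
    rw [eq_top_iff]
    rintro F -
    change F ∈ closure _
    rw [Metric.mem_closure_iff]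
    intro ε hε
    obtain ⟨K, hK, hKF⟩ : ∃ K : Set Y, IsCompact K ∧ ∀ y ∉ K, ‖F y‖ < ε / 2 := by
      have h := (Metric.tendsto_nhds.1 (zero_at_infty F)) (ε / 2) (half_pos hε)
      obtain ⟨K, hK, hKs⟩ := Filter.mem_cocompact.1 h
      exact ⟨K, hK, fun y hy => by simpa using hKs hy⟩
    obtain ⟨g, hg1, -, hgc, hg01⟩ := exists_continuous_one_zero_of_isCompact
      (hK.image q.continuous) isClosed_empty (Set.disjoint_empty _)
    let f : C₀(X, ℂ) :=
      { toFun := fun x => (g x : ℂ)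
        continuous_toFun := by fun_prop
        zero_at_infty' := by
          have : HasCompactSupport fun x => (g x : ℂ) :=
            hgc.comp_left (g := fun r : ℝ => (r : ℂ)) (by simp)
          exact this.is_zero_at_infty }
    refine ⟨compMul q f F, Submodule.subset_span ⟨f, F, rfl⟩, ?_⟩
    rw [dist_eq_norm, ← ZeroAtInftyContinuousMap.norm_toBCF_eq_norm]
    refine lt_of_le_of_lt ?_ (half_lt_self hε)
    rw [BoundedContinuousFunction.norm_le (half_pos hε).le]
    intro y
    change ‖F y - (g (q y) : ℂ) * F y‖ ≤ ε / 2
    by_cases hy : y ∈ K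
    · have : g (q y) = 1 := hg1 (Set.mem_image_of_mem q hy)
      simp [this, (half_pos hε).le]
    · have h1 : F y - (g (q y) : ℂ) * F y = ((1 - g (q y) : ℝ) : ℂ) * F y := by
        push_cast; ring
      have h2 : |1 - g (q y)| ≤ 1 := by
        have := hg01 (q y)
        rw [abs_le]; constructor <;> linarith [this.1, this.2]
      rw [h1, norm_mul, Complex.norm_real, Real.norm_eq_abs]
      exact (mul_le_of_le_one_left (norm_nonneg _) h2).trans (hKF y hy).le

variable [LocallyCompactSpace Y] [T2Space Y]

/-- The C*-algebra `q^*A = A ⊗_{C₀(X)} C₀(Y)`. -/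
abbrev PullbackAlgebra (α : C0Algebra X A) (q : C(Y, X)) : Type _ := α.BalancedTensor (ofMap q)

/-- The `C₀(Y)`-algebra `q^*A`, with `F' (a ⊗ F) = a ⊗ F' F` for `F, F' ∈ C₀(Y)`. -/
def pullback (α : C0Algebra X A) (q : C(Y, X)) : C0Algebra Y (α.PullbackAlgebra q) :=
  ((ofMap (ContinuousMap.id Y)).tensor A).quotient _

theorem pullback_act_tmul (α : C0Algebra X A) (q : C(Y, X)) (F' : C₀(Y, ℂ)) (a : A)
    (F : C₀(Y, ℂ)) :
    (α.pullback q).act F' (α.tmul (ofMap q) a F) = α.tmul (ofMap q) a (F' * F) :=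
  congrArg (α.balancedIdeal (ofMap q)).proj (MaxTensor.multiplier_fst_tmul _ a F)

/-- The space `Y ×_q A^♯ = {(y, z) : z ∈ A_{q(y)}}`, with the relative topology of `Y × A^♯`. -/
abbrev PullbackBundle (α : C0Algebra X A) (q : C(Y, X)) : Type _ :=
  {p : Y × α.Bundle // p.2.base = q p.1}

/-- The point `(y, z)` of `Y ×_q A^♯` given by `y ∈ Y` and `z ∈ A_{q(y)}`. -/
def PullbackBundle.mk (α : C0Algebra X A) (q : C(Y, X)) (y : Y) (z : α.Fiber (q y)) :
    α.PullbackBundle q := ⟨(y, ⟨q y, z⟩), rfl⟩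

end Pullback

end C0Algebra

end

/-! For each `y` there is one natural candidate: the evaluation `ev_y : q^*A → A_{q(y)}`, `a ⊗ F ↦
F(y) a_{q(y)}` (`pullbackEval`). It exists by the universal property of `⊗_max`, and it respects the
balancing relation because `(f a)_x = f(x) a_x` (`eval_act`). It turns the action of `F` into
multiplication by `F(y)`, so it kills `I_y q^*A` and descends to the fiber `(q^*A)_y`.

The substance of the fiberwise statement is injectivity. Fix `F₀ ∈ C₀(Y)` with `F₀(y) = 1`. In the
fiber at `y`, `(a ⊗ F)_y = F(y) (a ⊗ F₀)_y`, so every `t` in the span of elementary tensors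
satisfies `t_y = (c ⊗ F₀)_y` for some `c ∈ A` with `ev_y t = c_{q(y)}`. The vector `(c ⊗ F₀)_y`
depends only on `c_{q(y)}` and has norm at most `‖F₀‖ ‖c_{q(y)}‖`. Hence `‖t_y‖ ≤ ‖F₀‖ ‖ev_y t‖`, an
estimate with a constant independent of `t`, which therefore survives passage to the closure
(`norm_eval_le_mul_norm_pullbackEval`). Uniqueness holds because *-isomorphisms are isometric and
elementary tensors span a dense subspace.

For the topology, isometry of `φ_y` shows that `i(y, z)` is as far from `b_y` as `z` is from `ev_y
b`. Continuity of `i` then rests on `exists_eventually_norm_pullbackEval_sub_lt`: near a given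
point, `y ↦ ev_y b` is uniformly close to `y ↦ c_{q(y)}` for a single `c ∈ A`. Continuity of the
inverse rests on the converse device: near a given point, `y ↦ a_{q(y)}` equals `y ↦ ev_y (a ⊗ F)`
as soon as `F = 1` near that point. -/

noncomputable section

/-! ### Universal property of the maximal tensor product -/

namespace MaxTensor

variable {A B C : Type*} [NonUnitalCStarAlgebra A] [NonUnitalCStarAlgebra B]
  [NonUnitalCStarAlgebra C]

/-- The norm pulled back along `g` is one of the C*-seminorms whose supremum is the maximal one;
`hg` is the bound on elementary tensors required of these seminorms. -/
theorem norm_le_of_norm_tmul_le (g : PreMaxTensor A B →⋆ₙₐ[ℂ] C)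
    (hg : ∀ a b, ‖g (PreMaxTensor.tmul a b)‖ ≤ ‖a‖ * ‖b‖) (t : PreMaxTensor A B) :
    ‖g t‖ ≤ ‖t‖ := by
  let p : Seminorm ℂ (A ⊗[ℂ] B) :=
    (normSeminorm ℂ C).comp ((g : PreMaxTensor A B →ₗ[ℂ] C) : A ⊗[ℂ] B →ₗ[ℂ] C)
  have hp : p ∈ tensorCStarSeminorms A B := by
    refine ⟨⟨fun x y => ?_, fun x => ?_⟩, hg⟩
    · have h : ‖g ((show PreMaxTensor A B from x) * (show PreMaxTensor A B from y))‖ ≤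
          ‖g x‖ * ‖g y‖ := (congrArg norm (map_mul g _ _)).trans_le (norm_mul_le _ _)
      exact h
    · have h (z : PreMaxTensor A B) : ‖g (star z * z)‖ = ‖g z‖ ^ 2 := by
        rw [map_mul, map_star, CStarRing.norm_star_mul_self, pow_two]
      exact h x
  exact le_maxSeminorm hp t

/-- The extension to `A ⊗_max B` of a *-homomorphism on `A ⊙ B`. -/
def lift (g : PreMaxTensor A B →⋆ₙₐ[ℂ] C)
    (hg : ∀ a b, ‖g (PreMaxTensor.tmul a b)‖ ≤ ‖a‖ * ‖b‖) : MaxTensor A B →⋆ₙₐ[ℂ] C :=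
  let G : PreMaxTensor A B →L[ℂ] C := (g : PreMaxTensor A B →ₗ[ℂ] C).mkContinuous 1
    fun t => (norm_le_of_norm_tmul_le g hg t).trans_eq (one_mul _).symm
  let L : MaxTensor A B →L[ℂ] C := G.extend of.toContinuousLinearMap
  have hL (t : PreMaxTensor A B) : L (of t) = g t :=
    ContinuousLinearMap.extend_eq G (e := of.toContinuousLinearMap)
      isDenseInducing_of.dense isUniformInducing_of t
  { toFun := L
    map_smul' := map_smul L
    map_zero' := map_zero L
    map_add' := map_add L
    map_mul' := fun x y => by
      refine induction_on x (isClosed_eq (by fun_prop) (by fun_prop)) fun x => ?_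
      refine induction_on y (isClosed_eq (by fun_prop) (by fun_prop)) fun y => ?_
      rw [← of_mul, hL, hL, hL, map_mul]
    map_star' := fun x => by
      refine induction_on x (isClosed_eq (by fun_prop) (by fun_prop)) fun x => ?_
      rw [← of_star, hL, hL, map_star] }

theorem lift_tmul (g : PreMaxTensor A B →⋆ₙₐ[ℂ] C)
    (hg : ∀ a b, ‖g (PreMaxTensor.tmul a b)‖ ≤ ‖a‖ * ‖b‖) (a : A) (b : B) :
    lift g hg (tmul a b) = g (PreMaxTensor.tmul a b) :=
  ContinuousLinearMap.extend_eq _ (e := of.toContinuousLinearMap)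
    isDenseInducing_of.dense isUniformInducing_of _

theorem add_tmul (a b : A) (c : B) : tmul (a + b) c = tmul a c + tmul b c := by
  rw [tmul, tmul, tmul, ← of_add]
  exact congrArg of (TensorProduct.add_tmul a b c)

theorem smul_tmul (c : ℂ) (a : A) (b : B) : tmul (c • a) b = c • tmul a b := by
  rw [tmul, tmul, ← map_smul]
  rfl

end MaxTensor

/-! ### Kernels and homomorphisms out of quotients -/

namespace ClosedIdeal

variable {A C : Type*} [NonUnitalCStarAlgebra A] [NonUnitalCStarAlgebra C]

/-- The kernel of a *-homomorphism. -/
def ker (g : A →⋆ₙₐ[ℂ] C) : ClosedIdeal A where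
  __ := LinearMap.ker (g : A →ₗ[ℂ] C)
  mul_mem_left' a {x} hx := by
    change g (a * x) = 0
    rw [map_mul, show g x = 0 from hx, mul_zero]
  mul_mem_right' a {x} hx := by
    change g (x * a) = 0
    rw [map_mul, show g x = 0 from hx, zero_mul]
  star_mem' {x} hx := by
    change g (star x) = 0
    rw [map_star, show g x = 0 from hx, star_zero]
  isClosed' := isClosed_eq
    (NonUnitalStarAlgHom.instContinuousLinearMapClassComplex.map_continuous g) continuous_const

theorem mem_ker {g : A →⋆ₙₐ[ℂ] C} {x : A} : x ∈ (ker g).carrier ↔ g x = 0 := Iff.rfl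

theorem subset_generate (S : Set A) : S ⊆ (generate S).carrier := fun _ hx _ hJ => hJ hx

variable (I : ClosedIdeal A)

/-- The *-homomorphism on `A / I` induced by a *-homomorphism that vanishes on `I`. -/
def lift (g : A →⋆ₙₐ[ℂ] C) (hg : ∀ x ∈ I.toSubmodule, g x = 0) : I.Quot →⋆ₙₐ[ℂ] C :=
  let L : I.Quot →ₗ[ℂ] C := I.toSubmodule.liftQ (g : A →ₗ[ℂ] C) hg
  have hL (x : A) : L (I.proj x) = g x := rfl
  { toFun := L
    map_smul' := map_smul L
    map_zero' := map_zero L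
    map_add' := map_add L
    map_mul' := fun x y => by
      obtain ⟨x, rfl⟩ := proj_surjective x
      obtain ⟨y, rfl⟩ := proj_surjective y
      rw [← proj_mul, hL, hL, hL, map_mul]
    map_star' := fun x => by
      obtain ⟨x, rfl⟩ := proj_surjective x
      rw [← proj_star, hL, hL, map_star] }

end ClosedIdeal

/-! ### Cut-off functions -/

namespace ZeroAtInftyContinuousMap

variable {Y : Type*} [TopologicalSpace Y]

theorem norm_apply_le (F : C₀(Y, ℂ)) (y : Y) : ‖F y‖ ≤ ‖F‖ := F.toBCF.norm_coe_le_norm y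

/-- A compactly supported Urysohn function equal to 1 on a compact neighbourhood of `y`. The value
at `y` alone serves the computations in one fiber; the whole neighbourhood is needed for continuity
of the inverse bundle map. -/
theorem exists_eventually_eq_one [LocallyCompactSpace Y] [T2Space Y] (y : Y) :
    ∃ F : C₀(Y, ℂ), ∀ᶠ z in nhds y, F z = 1 := by
  obtain ⟨K, hK, hKy⟩ := exists_compact_mem_nhds y
  obtain ⟨g, hg1, -, hgc, -⟩ := exists_continuous_one_zero_of_isCompact
    hK isClosed_empty (Set.disjoint_empty _)
  refine ⟨⟨⟨fun z => (g z : ℂ), by fun_prop⟩, ?_⟩, ?_⟩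
  · have : HasCompactSupport fun z => (g z : ℂ) :=
      hgc.comp_left (g := fun r : ℝ => (r : ℂ)) (by simp)
    exact this.is_zero_at_infty
  · filter_upwards [hKy] with z hz
    change ((g z : ℝ) : ℂ) = 1
    rw [hg1 hz, Pi.one_apply, Complex.ofReal_one]

end ZeroAtInftyContinuousMap

namespace C0Algebra

/-! ### Fibers of a `C₀(X)`-algebra and elementary balanced tensors -/

section Basic

variable {X A B : Type*} [TopologicalSpace X] [NonUnitalCStarAlgebra A] [NonUnitalCStarAlgebra B]
  (α : C0Algebra X A)

theorem act_comp (f g : C₀(X, ℂ)) (a : A) : α.act f (α.act g a) = α.act (f * g) a := by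
  simp only [act, map_mul, DoubleCentralizer.mul_fst]
  rfl

theorem act_sub_smul (f g : C₀(X, ℂ)) (c : ℂ) (a : A) :
    α.act (f - c • g) a = α.act f a - c • α.act g a := by
  simp only [act, map_sub, map_smul, DoubleCentralizer.sub_fst, DoubleCentralizer.smul_fst]
  rfl

theorem mem_fiberIdeal_of_apply_eq_zero {x : X} {f : C₀(X, ℂ)} (hf : f x = 0) (a : A) :
    α.act f a ∈ (α.fiberIdeal x).toSubmodule :=
  Submodule.le_topologicalClosure _ (Submodule.subset_span ⟨f, a, hf, rfl⟩)

theorem fiberIdeal_induction {E : Type*} [NormedAddCommGroup E] [NormedSpace ℂ E] {x : X}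
    (g : A →L[ℂ] E) (hg : ∀ (f : C₀(X, ℂ)) (a : A), f x = 0 → g (α.act f a) = 0)
    {a : A} (ha : a ∈ (α.fiberIdeal x).toSubmodule) : g a = 0 := by
  -- With the target subspace `⊥`, membership means vanishing, so the closed-span principle
  -- propagates `g = 0` from the generators.
  refine (Submodule.mem_bot ℂ).1 (map_mem_of_mem_closedSpan (P := ⊥) (g := g) (by simp)
    g.continuous (map_zero g) (map_add g) (fun c x hx => ?_) ?_ ha)
  · rw [map_smul]
    exact Submodule.smul_mem _ _ hx
  · rintro _ ⟨f, a, hf, rfl⟩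
    exact (Submodule.mem_bot ℂ).2 (hg f a hf)

/-- The evaluation `a ↦ a_x` as a *-homomorphism. -/
def evalHom (x : X) : A →⋆ₙₐ[ℂ] α.Fiber x where
  toFun a := α.eval a x
  map_smul' c := map_smul (α.fiberIdeal x).proj c
  map_zero' := map_zero (α.fiberIdeal x).proj
  map_add' := map_add (α.fiberIdeal x).proj
  map_mul' := (α.fiberIdeal x).proj_mul
  map_star' := (α.fiberIdeal x).proj_star

theorem norm_eval_le (a : A) (x : X) : ‖α.eval a x‖ ≤ ‖a‖ := (α.fiberIdeal x).norm_proj_le a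

theorem continuous_eval (x : X) : Continuous fun a => α.eval a x :=
  (α.fiberIdeal x).continuous_proj

/-- The evaluation `a ↦ a_x` as a continuous linear map. -/
def evalCLM (x : X) : A →L[ℂ] α.Fiber x := ⟨(α.fiberIdeal x).proj, α.continuous_eval x⟩

theorem evalCLM_apply (x : X) (a : A) : α.evalCLM x a = α.eval a x := rfl

theorem eval_surjective (x : X) : Function.Surjective fun a => α.eval a x :=
  ClosedIdeal.proj_surjective

/-- Constants need not belong to `C₀(X)`, so `f - f(x)` cannot act directly. On a product `h b`,
however, `f (h b) - f(x) h b = (f h - f(x) h) b`, and `f h - f(x) h` does lie in `I_x`.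
Nondegeneracy extends the identity from such products to all of `A`. -/
theorem eval_act (f : C₀(X, ℂ)) (a : A) (x : X) : α.eval (α.act f a) x = f x • α.eval a x := by
  let g : A →L[ℂ] α.Fiber x := (α.evalCLM x).comp (α.θ f).fst - f x • α.evalCLM x
  have ha : a ∈ (Submodule.span ℂ {z : A | ∃ f a, (α.θ f).fst a = z}).topologicalClosure := by
    rw [α.nondegenerate]; trivial
  refine sub_eq_zero.1 (show g a = 0 from (Submodule.mem_bot ℂ).1
    (map_mem_of_mem_closedSpan (P := ⊥) (g := g) (by simp)
      g.continuous (map_zero g) (map_add g) (fun c x hx => ?_) ?_ ha))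
  · rw [map_smul]
    exact Submodule.smul_mem _ _ hx
  · rintro _ ⟨h, b, rfl⟩
    rw [Submodule.mem_bot]
    change α.evalCLM x (α.act f (α.act h b)) - f x • α.evalCLM x (α.act h b) = 0
    rw [act_comp, ← map_smul, ← map_sub, ← act_sub_smul, evalCLM_apply, eval,
      ← map_zero (α.fiberIdeal x).proj, ClosedIdeal.proj_eq_proj, sub_zero]
    exact α.mem_fiberIdeal_of_apply_eq_zero (by simp) b

theorem isOpen_basicSet {U : Set X} (hU : IsOpen U) (a : A) {ε : ℝ} (hε : 0 < ε) :
    IsOpen (α.basicSet U a ε) :=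
  TopologicalSpace.isOpen_generateFrom_of_mem ⟨U, a, ε, hU, hε, rfl⟩

theorem continuous_base : Continuous (Bundle.base : α.Bundle → X) := by
  refine continuous_def.2 fun U hU => ?_
  -- The tubes around the zero section exhaust the bundle over `U`; the radius `n + 1` keeps every
  -- tube of positive radius.
  have : Bundle.base ⁻¹' U = ⋃ n : ℕ, α.basicSet U 0 (n + 1) := by
    ext z
    simp only [Set.mem_preimage, Set.mem_iUnion, basicSet, Set.mem_ofPred_eq]
    refine ⟨fun hz => ?_, fun ⟨_, h⟩ => h.1⟩
    obtain ⟨n, hn⟩ := exists_nat_gt ‖z.val - α.eval 0 z.base‖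
    exact ⟨n, hz, hn.trans (lt_add_one _)⟩
  rw [this]
  exact isOpen_iUnion fun n => α.isOpen_basicSet hU 0 (by positivity)

section Tensor

variable (β : C0Algebra X B)

/-- The map `a ↦ a ⊗ b` into the balanced tensor product. -/
def tmulCLM (b : B) : A →L[ℂ] α.BalancedTensor β :=
  LinearMap.mkContinuous
    { toFun := fun a => α.tmul β a b
      map_add' := fun a c => by rw [tmul, MaxTensor.add_tmul, map_add]; rfl
      map_smul' := fun c a => by rw [tmul, MaxTensor.smul_tmul, map_smul]; rfl }
    ‖b‖ fun a => by
      rw [mul_comm]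
      exact (ClosedIdeal.norm_proj_le _ _).trans (MaxTensor.norm_tmul_le a b)

theorem tmulCLM_apply (a : A) (b : B) : α.tmulCLM β b a = α.tmul β a b := rfl

theorem act_tmul (f : C₀(X, ℂ)) (a : A) (b : B) :
    α.tmul β (α.act f a) b = α.tmul β a (β.act f b) :=
  ClosedIdeal.proj_eq_proj.2 (ClosedIdeal.subset_generate _ ⟨f, a, b, rfl⟩)

theorem dense_span_tmul : Dense (Submodule.span ℂ {z | ∃ a b, α.tmul β a b = z} : Set
    (α.BalancedTensor β)) := by
  rw [Submodule.dense_iff_topologicalClosure_eq_top, eq_top_iff]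
  rintro z -
  obtain ⟨t, rfl⟩ := ClosedIdeal.proj_surjective z
  have ht : t ∈ (Submodule.span ℂ
      {z : MaxTensor A B | ∃ a b, MaxTensor.tmul a b = z}).topologicalClosure := by
    rw [MaxTensor.dense_span_tmul]; trivial
  refine map_mem_of_mem_closedSpan (Submodule.isClosed_topologicalClosure _)
    (ClosedIdeal.continuous_proj _) (map_zero _) (map_add _) (fun c x hx => ?_) ?_ ht
  · rw [map_smul]; exact Submodule.smul_mem _ _ hx
  · rintro _ ⟨a, b, rfl⟩
    exact Submodule.le_topologicalClosure _ (Submodule.subset_span ⟨a, b, rfl⟩)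

end Tensor

end Basic

/-! ### The evaluations `q^*A → A_{q(y)}` -/

section Pullback

variable {X Y A : Type*} [TopologicalSpace X] [TopologicalSpace Y] [NonUnitalCStarAlgebra A]
  (α : C0Algebra X A)

/-- The *-homomorphism `a ⊗ F ↦ F(y) a_x` on the algebraic tensor product. -/
def preFiberHom (x : X) (y : Y) : PreMaxTensor A C₀(Y, ℂ) →⋆ₙₐ[ℂ] α.Fiber x :=
  let b : A →ₗ[ℂ] C₀(Y, ℂ) →ₗ[ℂ] α.Fiber x :=
    LinearMap.mk₂ ℂ (fun a F => F y • α.evalHom x a)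
      (fun a b F => by rw [map_add, smul_add])
      (fun c a F => by rw [map_smul, smul_comm])
      (fun a F G => by rw [ZeroAtInftyContinuousMap.add_apply, add_smul])
      (fun c a F => by rw [ZeroAtInftyContinuousMap.smul_apply, smul_assoc])
  let L : PreMaxTensor A C₀(Y, ℂ) →ₗ[ℂ] α.Fiber x := TensorProduct.lift b
  have hL (a : A) (F : C₀(Y, ℂ)) : L (PreMaxTensor.tmul a F) = F y • α.evalHom x a := rfl
  { toFun := L
    map_smul' := map_smul L
    map_zero' := map_zero L
    map_add' := map_add L
    map_mul' := fun s t => by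
      induction s using PreMaxTensor.induction_on with
      | zero => simp
      | add s s' hs hs' => rw [add_mul, map_add, map_add, add_mul, hs, hs']
      | tmul a F =>
        induction t using PreMaxTensor.induction_on with
        | zero => simp
        | add t t' ht ht' => rw [mul_add, map_add, map_add, mul_add, ht, ht']
        | tmul b G =>
          rw [PreMaxTensor.tmul_mul_tmul, hL, hL, hL, map_mul, smul_mul_smul_comm]
          rfl
    map_star' := fun t => by
      induction t using PreMaxTensor.induction_on with
      | zero => simp
      | add t t' ht ht' => rw [star_add, map_add, map_add, star_add, ht, ht']
      | tmul a F =>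
        rw [PreMaxTensor.star_tmul, hL, hL, star_smul, map_star]
        rfl }

theorem preFiberHom_tmul (x : X) (y : Y) (a : A) (F : C₀(Y, ℂ)) :
    α.preFiberHom x y (PreMaxTensor.tmul a F) = F y • α.eval a x := rfl

theorem norm_preFiberHom_tmul_le (x : X) (y : Y) (a : A) (F : C₀(Y, ℂ)) :
    ‖α.preFiberHom x y (PreMaxTensor.tmul a F)‖ ≤ ‖a‖ * ‖F‖ := by
  rw [preFiberHom_tmul, norm_smul, mul_comm]
  gcongr
  · exact α.norm_eval_le a x
  · exact F.norm_apply_le y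

variable [LocallyCompactSpace X] [T2Space X] (q : C(Y, X))

/-- The *-homomorphism `q^*A → A_{q(y)}` with `a ⊗ F ↦ F(y) a_{q(y)}`. -/
def pullbackEval (y : Y) : α.PullbackAlgebra q →⋆ₙₐ[ℂ] α.Fiber (q y) :=
  let g := MaxTensor.lift (α.preFiberHom (q y) y) (α.norm_preFiberHom_tmul_le (q y) y)
  -- The balanced ideal is the intersection of the closed ideals containing its generators, and `ker
  -- g` is one of these: both halves of a generator go to `f(q(y)) F(y) a_{q(y)}`.
  (α.balancedIdeal (ofMap q)).lift g fun _ hx => hx (ClosedIdeal.ker g) <| by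
    rintro _ ⟨f, a, F, rfl⟩
    rw [ClosedIdeal.mem_ker, map_sub, MaxTensor.lift_tmul, MaxTensor.lift_tmul, preFiberHom_tmul,
      preFiberHom_tmul, eval_act, smul_smul, sub_eq_zero, mul_comm]
    rfl

theorem pullbackEval_tmul (y : Y) (a : A) (F : C₀(Y, ℂ)) :
    α.pullbackEval q y (α.tmul (ofMap q) a F) = F y • α.eval a (q y) :=
  MaxTensor.lift_tmul _ (α.norm_preFiberHom_tmul_le (q y) y) a F

theorem continuous_pullbackEval (y : Y) : Continuous (α.pullbackEval q y) :=
  NonUnitalStarAlgHom.instContinuousLinearMapClassComplex.map_continuous _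

/-- For `a ⊗ F` the choice `c = F(y₀) a` works by continuity of `F`. Linearity gives the span, and
contractivity of every `ev_y` makes the approximation of `t` by the span uniform in `y`. -/
theorem exists_eventually_norm_pullbackEval_sub_lt (t : α.PullbackAlgebra q) (y₀ : Y) {δ : ℝ}
    (hδ : 0 < δ) :
    ∃ c : A, ∀ᶠ y in nhds y₀, ‖α.pullbackEval q y t - α.eval c (q y)‖ < δ := by
  -- On the span the error tends to 0, so one `c` serves every tolerance; a tolerance-dependent `c`
  -- enters only with the closure.
  have hspan : ∀ s ∈ Submodule.span ℂ {z | ∃ a F, α.tmul (ofMap q) a F = z}, ∃ c : A,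
      Filter.Tendsto (fun y => ‖α.pullbackEval q y s - α.evalCLM (q y) c‖) (nhds y₀)
        (nhds 0) := by
    intro s hs
    induction hs using Submodule.span_induction with
    | mem s hs =>
      obtain ⟨a, F, rfl⟩ := hs
      refine ⟨F y₀ • a, squeeze_zero (g := fun y => ‖F y - F y₀‖ * ‖a‖)
        (fun _ => norm_nonneg _) (fun y => ?_) ?_⟩
      · rw [pullbackEval_tmul, map_smul, evalCLM_apply, ← sub_smul, norm_smul]
        gcongr
        exact α.norm_eval_le a (q y)
      · have : Filter.Tendsto (fun y => ‖F y - F y₀‖ * ‖a‖) (nhds y₀)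
            (nhds (‖F y₀ - F y₀‖ * ‖a‖)) := Continuous.tendsto (by fun_prop) y₀
        simpa using this
    | zero =>
      refine ⟨0, ?_⟩
      simp only [map_zero, sub_zero, norm_zero]
      exact tendsto_const_nhds
    | add s t _ _ hs ht =>
      obtain ⟨c, hc⟩ := hs
      obtain ⟨d, hd⟩ := ht
      refine ⟨c + d, squeeze_zero (fun _ => norm_nonneg _) (fun y => ?_)
        (by simpa only [add_zero] using hc.add hd)⟩
      rw [map_add, map_add, add_sub_add_comm]
      exact norm_add_le _ _
    | smul k t _ ht =>
      obtain ⟨c, hc⟩ := ht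
      refine ⟨k • c, ?_⟩
      simp only [map_smul, ← smul_sub, norm_smul]
      simpa only [mul_zero] using hc.const_mul ‖k‖
  obtain ⟨s, hs, hst⟩ := Metric.mem_closure_iff.1 (α.dense_span_tmul (ofMap q) t) (δ / 2)
    (half_pos hδ)
  obtain ⟨c, hc⟩ := hspan s hs
  refine ⟨c, ?_⟩
  filter_upwards [hc.eventually_lt_const (half_pos hδ)] with y hy
  have h1 : ‖α.pullbackEval q y t - α.pullbackEval q y s‖ < δ / 2 := by
    rw [← map_sub]
    refine (NonUnitalStarAlgHom.norm_apply_le _ _).trans_lt ?_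
    rwa [← dist_eq_norm]
  calc _ ≤ ‖α.pullbackEval q y t - α.pullbackEval q y s‖ +
        ‖α.pullbackEval q y s - α.eval c (q y)‖ := norm_sub_le_norm_sub_add_norm_sub _ _ _
    _ < δ / 2 + δ / 2 := add_lt_add h1 hy
    _ = δ := add_halves δ

/-! ### The isomorphism of fibers -/

variable [LocallyCompactSpace Y] [T2Space Y]

/-- Both sides are continuous and linear in `t` and agree on elementary tensors. This is what makes
`ev_y` vanish on `I_y q^*A`. -/
theorem pullbackEval_act (y : Y) (F : C₀(Y, ℂ)) (t : α.PullbackAlgebra q) :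
    α.pullbackEval q y ((α.pullback q).act F t) = F y • α.pullbackEval q y t := by
  let g : α.PullbackAlgebra q →L[ℂ] α.Fiber (q y) :=
    ⟨(α.pullbackEval q y : α.PullbackAlgebra q →ₗ[ℂ] α.Fiber (q y)),
      α.continuous_pullbackEval q y⟩
  have : g.comp ((α.pullback q).θ F).fst = F y • g := by
    refine ContinuousLinearMap.ext_on (α.dense_span_tmul (ofMap q)) ?_
    rintro _ ⟨a, G, rfl⟩
    change α.pullbackEval q y ((α.pullback q).act F (α.tmul (ofMap q) a G)) =
      F y • α.pullbackEval q y (α.tmul (ofMap q) a G)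
    rw [pullback_act_tmul, pullbackEval_tmul, pullbackEval_tmul, smul_smul]
    rfl
  exact congrArg (fun h : α.PullbackAlgebra q →L[ℂ] α.Fiber (q y) => h t) this

/-- The *-homomorphism `(q^*A)_y → A_{q(y)}` with `(a ⊗ F)_y ↦ F(y) a_{q(y)}`. -/
def pullbackFiberHom (y : Y) : (α.pullback q).Fiber y →⋆ₙₐ[ℂ] α.Fiber (q y) :=
  ((α.pullback q).fiberIdeal y).lift (α.pullbackEval q y) fun _ hx =>
    (α.pullback q).fiberIdeal_induction
      ⟨(α.pullbackEval q y : α.PullbackAlgebra q →ₗ[ℂ] α.Fiber (q y)),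
        α.continuous_pullbackEval q y⟩
      (fun F t hF => (α.pullbackEval_act q y F t).trans (by rw [hF, zero_smul])) hx

theorem pullbackFiberHom_eval_tmul (y : Y) (a : A) (F : C₀(Y, ℂ)) :
    α.pullbackFiberHom q y ((α.pullback q).eval (α.tmul (ofMap q) a F) y) =
      F y • α.eval a (q y) :=
  α.pullbackEval_tmul q y a F

/-- The element `a ⊗ F F₀` is both `F (a ⊗ F₀)` and `F₀ (a ⊗ F)`; take the value at `y` of each
form. -/
theorem eval_tmul_eq_smul {y : Y} {F₀ : C₀(Y, ℂ)} (hF₀ : F₀ y = 1) (a : A) (F : C₀(Y, ℂ)) :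
    (α.pullback q).eval (α.tmul (ofMap q) a F) y =
      F y • (α.pullback q).eval (α.tmul (ofMap q) a F₀) y := by
  rw [← eval_act, pullback_act_tmul, mul_comm, ← pullback_act_tmul, eval_act, hF₀, one_smul]

/-- On a generator `f b` with `f(q(y)) = 0`, balancing moves `f` across the tensor sign, and the
second factor `(f ∘ q) F` then vanishes at `y`. Thus `(a ⊗ F)_y` depends on `a` only through
`a_{q(y)}`. -/
theorem eval_tmul_eq_zero {y : Y} {a : A} (ha : α.eval a (q y) = 0) (F : C₀(Y, ℂ)) :
    (α.pullback q).eval (α.tmul (ofMap q) a F) y = 0 := by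
  obtain ⟨F₀, hF₀⟩ := ZeroAtInftyContinuousMap.exists_eventually_eq_one y
  have ha' : a ∈ (α.fiberIdeal (q y)).toSubmodule := by
    rw [← sub_zero a]
    exact ClosedIdeal.proj_eq_proj.1 (ha.trans (map_zero _).symm)
  refine α.fiberIdeal_induction
    (((α.pullback q).evalCLM y).comp (α.tmulCLM (ofMap q) F)) (fun f b hf => ?_) ha'
  change (α.pullback q).eval (α.tmul (ofMap q) (α.act f b) F) y = 0
  rw [act_tmul, α.eval_tmul_eq_smul q hF₀.self_of_nhds]
  change (f (q y) * F y) • _ = _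
  rw [hf, zero_mul, zero_smul]

/-- For `a ⊗ F` take `c = F(y) a`; both equations are linear in the pair `(t, c)`. That the same `c`
serves both is what allows `t_y` to be compared with `ev_y t`. -/
theorem exists_eval_eq_eval_tmul {y : Y} {F₀ : C₀(Y, ℂ)} (hF₀ : F₀ y = 1)
    {t : α.PullbackAlgebra q}
    (ht : t ∈ Submodule.span ℂ {z | ∃ a F, α.tmul (ofMap q) a F = z}) :
    ∃ c : A, (α.pullback q).eval t y = (α.pullback q).eval (α.tmul (ofMap q) c F₀) y ∧
      α.pullbackEval q y t = α.eval c (q y) := by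
  let χ : A →L[ℂ] (α.pullback q).Fiber y :=
    ((α.pullback q).evalCLM y).comp (α.tmulCLM (ofMap q) F₀)
  suffices h : ∃ c : A, (α.pullback q).evalCLM y t = χ c ∧
      α.pullbackEval q y t = α.evalCLM (q y) c from h
  induction ht using Submodule.span_induction with
  | mem t ht =>
    obtain ⟨a, F, rfl⟩ := ht
    refine ⟨F y • a, ?_, ?_⟩
    · rw [map_smul]
      exact α.eval_tmul_eq_smul q hF₀ a F
    · rw [map_smul]
      exact α.pullbackEval_tmul q y a F
  | zero => exact ⟨0, by rw [map_zero, map_zero], by rw [map_zero, map_zero]⟩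
  | add s t _ _ hs ht =>
    obtain ⟨c, hc, hc'⟩ := hs
    obtain ⟨d, hd, hd'⟩ := ht
    exact ⟨c + d, by rw [map_add, map_add, hc, hd], by rw [map_add, map_add, hc', hd']⟩
  | smul k t _ ht =>
    obtain ⟨c, hc, hc'⟩ := ht
    exact ⟨k • c, by rw [map_smul, map_smul, hc], by rw [map_smul, map_smul, hc']⟩

/-- Replace `c` by a representative `d` of `c_{q(y)}` of nearly minimal norm, which leaves `(c ⊗
F)_y` unchanged, and use `‖d ⊗ F‖ ≤ ‖d‖ ‖F‖`. -/
theorem norm_eval_tmul_le (y : Y) (c : A) (F : C₀(Y, ℂ)) :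
    ‖(α.pullback q).eval (α.tmul (ofMap q) c F) y‖ ≤ ‖F‖ * ‖α.eval c (q y)‖ := by
  have key : ∀ ε > 0, ‖(α.pullback q).eval (α.tmul (ofMap q) c F) y‖ ≤
      ‖F‖ * (‖α.eval c (q y)‖ + ε) := by
    intro ε hε
    obtain ⟨d, hd, hdn⟩ := (α.fiberIdeal (q y)).exists_norm_lt (α.eval c (q y)) hε
    have h0 : α.eval (c - d) (q y) = 0 := by
      rw [← evalCLM_apply, map_sub, sub_eq_zero]
      exact hd.symm
    have h1 : (α.pullback q).eval (α.tmul (ofMap q) c F) y =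
        (α.pullback q).eval (α.tmul (ofMap q) d F) y := by
      have h2 := α.eval_tmul_eq_zero q h0 F
      rwa [← tmulCLM_apply, ← evalCLM_apply, map_sub, map_sub, sub_eq_zero] at h2
    rw [h1, mul_comm]
    refine ((norm_eval_le _ _ y).trans (ClosedIdeal.norm_proj_le _ _)).trans
      ((MaxTensor.norm_tmul_le d F).trans ?_)
    gcongr
  have ht : Filter.Tendsto (fun ε : ℝ => ‖F‖ * (‖α.eval c (q y)‖ + ε))
      (nhdsWithin 0 (Set.Ioi 0)) (nhds (‖F‖ * (‖α.eval c (q y)‖ + 0))) :=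
    ((Continuous.tendsto (by fun_prop) 0)).mono_left nhdsWithin_le_nhds
  rw [add_zero] at ht
  exact ge_of_tendsto ht (Filter.eventually_of_mem self_mem_nhdsWithin key)

/-- This is the injectivity of the fiber map in quantitative form. The inequality is a closed
condition on `t`, so it need only be checked on the span of elementary tensors. -/
theorem norm_eval_le_mul_norm_pullbackEval {y : Y} {F₀ : C₀(Y, ℂ)} (hF₀ : F₀ y = 1)
    (t : α.PullbackAlgebra q) :
    ‖(α.pullback q).eval t y‖ ≤ ‖F₀‖ * ‖α.pullbackEval q y t‖ := by
  have hcl : IsClosed {t : α.PullbackAlgebra q |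
      ‖(α.pullback q).eval t y‖ ≤ ‖F₀‖ * ‖α.pullbackEval q y t‖} :=
    isClosed_le ((α.pullback q).continuous_eval y).norm
      (continuous_const.mul (α.continuous_pullbackEval q y).norm)
  refine hcl.closure_subset_iff.2 (fun t ht => ?_) (α.dense_span_tmul (ofMap q) t)
  obtain ⟨c, hc, hc'⟩ := α.exists_eval_eq_eval_tmul q hF₀ ht
  change ‖(α.pullback q).eval t y‖ ≤ ‖F₀‖ * ‖α.pullbackEval q y t‖
  rw [hc, hc']
  exact α.norm_eval_tmul_le q y c F₀

theorem pullbackFiberHom_bijective (y : Y) : Function.Bijective (α.pullbackFiberHom q y) := by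
  obtain ⟨F₀, hF₀⟩ := ZeroAtInftyContinuousMap.exists_eventually_eq_one y
  constructor
  · refine (injective_iff_map_eq_zero _).2 fun z hz => ?_
    obtain ⟨t, rfl⟩ := (α.pullback q).eval_surjective y z
    have h := α.norm_eval_le_mul_norm_pullbackEval q hF₀.self_of_nhds t
    rw [show α.pullbackEval q y t = 0 from hz, norm_zero, mul_zero] at h
    exact norm_le_zero_iff.1 h
  · intro z
    obtain ⟨a, rfl⟩ := α.eval_surjective (q y) z
    refine ⟨(α.pullback q).eval (α.tmul (ofMap q) a F₀) y, ?_⟩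
    rw [pullbackFiberHom_eval_tmul, hF₀.self_of_nhds, one_smul]

/-- The *-isomorphism `(q^*A)_y ≃ A_{q(y)}`. -/
def pullbackFiberEquiv (y : Y) : (α.pullback q).Fiber y ≃⋆ₐ[ℂ] α.Fiber (q y) :=
  StarAlgEquiv.ofBijective (α.pullbackFiberHom q y) (α.pullbackFiberHom_bijective q y)

/-- A *-isomorphism is isometric, hence determined by its values on the dense span. This gives
uniqueness and lets the bundle argument treat an arbitrary admissible family `φ`. -/
theorem starAlgEquiv_eval_eq_pullbackEval {y : Y}
    (φ : (α.pullback q).Fiber y ≃⋆ₐ[ℂ] α.Fiber (q y))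
    (hφ : ∀ (a : A) (F : C₀(Y, ℂ)),
      φ ((α.pullback q).eval (α.tmul (ofMap q) a F) y) = F y • α.eval a (q y))
    (t : α.PullbackAlgebra q) :
    φ ((α.pullback q).eval t y) = α.pullbackEval q y t := by
  let g : α.PullbackAlgebra q →L[ℂ] α.Fiber (q y) :=
    ⟨(α.pullbackEval q y : α.PullbackAlgebra q →ₗ[ℂ] α.Fiber (q y)),
      α.continuous_pullbackEval q y⟩
  let g' : α.PullbackAlgebra q →L[ℂ] α.Fiber (q y) :=
    { toFun t := φ ((α.pullback q).evalCLM y t)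
      map_add' := fun s t => by rw [map_add, map_add]
      map_smul' := fun c t => by rw [map_smul, map_smul]; rfl
      cont := (StarAlgEquiv.isometry φ).continuous.comp ((α.pullback q).evalCLM y).continuous }
  have : g' = g := by
    refine ContinuousLinearMap.ext_on (α.dense_span_tmul (ofMap q)) ?_
    rintro _ ⟨a, F, rfl⟩
    exact (hφ a F).trans (α.pullbackEval_tmul q y a F).symm
  exact congrArg (fun h : α.PullbackAlgebra q →L[ℂ] α.Fiber (q y) => h t) this

/-! ### The homeomorphism of bundles -/

section Bundle

variable {q} {φ : ∀ y : Y, (α.pullback q).Fiber y ≃⋆ₐ[ℂ] α.Fiber (q y)}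

/-- The bijection `Y ×_q A^♯ → (q^*A)^♯` given by isomorphisms `(q^*A)_y ≃ A_{q(y)}`. -/
def pullbackBundleEquiv (φ : ∀ y : Y, (α.pullback q).Fiber y ≃⋆ₐ[ℂ] α.Fiber (q y)) :
    α.PullbackBundle q ≃ (α.pullback q).Bundle where
  -- The base point of `p.1.2` is only provably equal to `q p.1.1`, so its value is transported
  -- along `p.2`.
  toFun p := ⟨p.1.1, (φ p.1.1).symm (p.2 ▸ p.1.2.val)⟩
  invFun w := PullbackBundle.mk α q w.base (φ w.base w.val)
  left_inv := by
    rintro ⟨⟨y, ⟨x, z⟩⟩, h⟩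
    change x = q y at h
    subst h
    simp [PullbackBundle.mk]
  right_inv w := by
    change Bundle.mk w.base ((φ w.base).symm (φ w.base w.val)) = w
    rw [StarAlgEquiv.symm_apply_apply]

theorem pullbackBundleEquiv_mk (y : Y) (z : α.Fiber (q y)) :
    α.pullbackBundleEquiv φ (PullbackBundle.mk α q y z) = ⟨y, (φ y).symm z⟩ := rfl

/-- Near `y₀` the field `y ↦ ev_y b` may be replaced, up to `δ`, by `y ↦ c_{q(y)}`, and tubes around
`c` are open in `A^♯` by definition. -/
theorem continuous_pullbackBundleEquiv
    (hφ : ∀ y (t : α.PullbackAlgebra q),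
      φ y ((α.pullback q).eval t y) = α.pullbackEval q y t) :
    Continuous (α.pullbackBundleEquiv φ) := by
  refine continuous_generateFrom_iff.2 ?_
  rintro _ ⟨U, b, ε, hU, hε, rfl⟩
  have hnorm (y : Y) (z : α.Fiber (q y)) :
      ‖(φ y).symm z - (α.pullback q).eval b y‖ = ‖z - α.pullbackEval q y b‖ := by
    rw [← StarAlgEquiv.norm_map (φ y), map_sub, StarAlgEquiv.apply_symm_apply, hφ]
  refine isOpen_iff_mem_nhds.2 ?_
  rintro ⟨⟨y₀, ⟨x₀, z₀⟩⟩, h₀⟩ ⟨hU₀, hz₀⟩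
  change x₀ = q y₀ at h₀
  subst h₀
  change ‖(φ y₀).symm z₀ - (α.pullback q).eval b y₀‖ < ε at hz₀
  rw [hnorm] at hz₀
  -- One `δ` pays for exchanging `b` with `c` at `y₀`, the other for exchanging back at a nearby
  -- `y`.
  obtain ⟨δ, hδ, hδε⟩ : ∃ δ > 0, ‖z₀ - α.pullbackEval q y₀ b‖ + δ + δ < ε :=
    ⟨(ε - ‖z₀ - α.pullbackEval q y₀ b‖) / 3, by linarith, by linarith⟩
  obtain ⟨c, hc⟩ := α.exists_eventually_norm_pullbackEval_sub_lt q b y₀ hδ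
  -- The tube around `c` restricts only the fiber coordinate, hence the base set `univ`; `y` is kept
  -- near `y₀` and inside `U` by `hV`.
  have hW := (α.isOpen_basicSet isOpen_univ c
    (show 0 < ‖z₀ - α.pullbackEval q y₀ b‖ + δ by positivity)).preimage
      (continuous_snd.comp continuous_subtype_val : Continuous fun p : α.PullbackBundle q => p.1.2)
  have hfst : Continuous fun p : α.PullbackBundle q => p.1.1 :=
    continuous_fst.comp continuous_subtype_val
  have hV := (hfst.tendsto ⟨(y₀, ⟨q y₀, z₀⟩), rfl⟩).eventually (hc.and (hU.eventually_mem hU₀))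
  filter_upwards [hV, hW.mem_nhds ⟨trivial,
    (norm_sub_le_norm_sub_add_norm_sub z₀ (α.pullbackEval q y₀ b) _).trans_lt
      (add_lt_add_right hc.self_of_nhds _)⟩]
  rintro ⟨⟨y, ⟨x, z⟩⟩, h⟩ ⟨hy, hyU⟩ ⟨-, hz⟩
  change x = q y at h
  subst h
  refine ⟨hyU, ?_⟩
  change ‖(φ y).symm z - (α.pullback q).eval b y‖ < ε
  change ‖z - α.eval c (q y)‖ < _ at hz
  change ‖α.pullbackEval q y b - α.eval c (q y)‖ < δ at hy
  rw [hnorm]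
  rw [norm_sub_rev] at hy
  linarith [norm_sub_le_norm_sub_add_norm_sub z (α.eval c (q y)) (α.pullbackEval q y b)]

/-- The first coordinate is the bundle projection. For the second, a cut-off `F` equal to 1 near the
base point makes the preimage of `U(a, ε)` agree locally with the basic set of `a ⊗ F` over
`q⁻¹(U)`, with the same `ε`. -/
theorem continuous_pullbackBundleEquiv_symm
    (hφ : ∀ y (t : α.PullbackAlgebra q),
      φ y ((α.pullback q).eval t y) = α.pullbackEval q y t) :
    Continuous (α.pullbackBundleEquiv φ).symm := by
  have hbase := (α.pullback q).continuous_base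
  refine Continuous.subtype_mk (hbase.prodMk (continuous_generateFrom_iff.2 ?_)) _
  rintro _ ⟨U, a, ε, hU, hε, rfl⟩
  refine isOpen_iff_mem_nhds.2 fun w₀ hw₀ => ?_
  obtain ⟨F, hF⟩ := ZeroAtInftyContinuousMap.exists_eventually_eq_one w₀.base
  have key (w : (α.pullback q).Bundle) (hw : F w.base = 1) :
      ‖φ w.base w.val - α.eval a (q w.base)‖ =
        ‖w.val - (α.pullback q).eval (α.tmul (ofMap q) a F) w.base‖ := by
    rw [← StarAlgEquiv.norm_map (φ w.base) (w.val - _), map_sub, hφ, pullbackEval_tmul, hw,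
      one_smul]
  have hW := (α.pullback q).isOpen_basicSet (hU.preimage q.continuous)
    (α.tmul (ofMap q) a F) hε
  filter_upwards [hbase.continuousAt.eventually hF,
    hW.mem_nhds ⟨hw₀.1, (key w₀ hF.self_of_nhds).symm.trans_lt hw₀.2⟩] with w hw hw'
  exact ⟨hw'.1, (key w hw).trans_lt hw'.2⟩

end Bundle

end Pullback

end C0Algebra

end

theorem mainTheorem12 {X Y A : Type*} [TopologicalSpace X] [LocallyCompactSpace X] [T2Space X]
    [TopologicalSpace Y] [LocallyCompactSpace Y] [T2Space Y] [NonUnitalCStarAlgebra A]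
    (α : C0Algebra X A) (q : C(Y, X)) :
    (∃! φ : ∀ y : Y, (α.pullback q).Fiber y ≃⋆ₐ[ℂ] α.Fiber (q y),
      ∀ (y : Y) (a : A) (F : C₀(Y, ℂ)),
        φ y ((α.pullback q).eval (α.tmul (C0Algebra.ofMap q) a F) y) = F y • α.eval a (q y)) ∧
    (IsOpenMap q → ∀ φ : ∀ y : Y, (α.pullback q).Fiber y ≃⋆ₐ[ℂ] α.Fiber (q y),
      (∀ (y : Y) (a : A) (F : C₀(Y, ℂ)),
        φ y ((α.pullback q).eval (α.tmul (C0Algebra.ofMap q) a F) y) = F y • α.eval a (q y)) →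
      ∃ i : α.PullbackBundle q ≃ₜ (α.pullback q).Bundle,
        ∀ (y : Y) (z : α.Fiber (q y)),
          i (C0Algebra.PullbackBundle.mk α q y z) = ⟨y, (φ y).symm z⟩) := by
  constructor
  · refine ⟨α.pullbackFiberEquiv q, fun y => α.pullbackFiberHom_eval_tmul q y, ?_⟩
    intro φ hφ
    funext y
    ext z
    obtain ⟨t, rfl⟩ := (α.pullback q).eval_surjective y z
    exact α.starAlgEquiv_eval_eq_pullbackEval q (φ y) (hφ y) t
  · intro _ φ hφ
    have h (y : Y) := α.starAlgEquiv_eval_eq_pullbackEval q (φ y) (hφ y)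
    exact ⟨⟨α.pullbackBundleEquiv φ, α.continuous_pullbackBundleEquiv h,
      α.continuous_pullbackBundleEquiv_symm h⟩, α.pullbackBundleEquiv_mk⟩
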